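/- Let $d\in\mathbb N$, $\alpha\in(0,1)$ and $0<T<\infty$. Put $\mathbb T^d=\mathbb R^d/\mathbb Z^d$, $Q_T=(0,T]\times\mathbb T^d$, $\overline{Q_T}=[0,T]\times\mathbb T^d$; functions on $\mathbb T^d$ are regarded as $\mathbb Z^d$-periodic functions on $\mathbb R^d$, and $|\cdot|$ is the Euclidean norm. Consider $$\partial_t^\alpha u+H(t,x,u,Du)=0\ \text{ in } Q_T,\qquad u(0,\cdot)=u_0\ \text{ on }\mathbb T^d,\tag{1}$$ where $\partial_t^\alpha$ is Caputo's time-fractional derivative of order $\alpha$ and solutions are understood in the following viscosity sense. For $f:[0,T]\to\mathbb R$ and $0<r\le t\le T$ let $$J_r[f](t)=\frac{\alpha}{\Gamma(1-\alpha)}\int_0^r\frac{f(t)-f(t-\tau)}{\tau^{\alpha+1}}\,d\tau,\qquad K_r[f](t)=\frac{f(t)-f(0)}{t^\alpha\Gamma(1-\alpha)}+\frac{\alpha}{\Gamma(1-\alpha)}\int_r^t\frac{f(t)-f(t-\tau)}{\tau^{\alpha+1}}\,d\tau,$$ and, for functions of $(t,x)$, let $J_r$ and $K_r$ act on the variable $t$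 with $x$ fixed. Let $\mathcal C^1([0,T]\times\mathbb R^d)$ be the set of $\phi\in C^1((0,T]\times\mathbb R^d)\cap C([0,T]\times\mathbb R^d)$ with $\partial_t\phi(\cdot,x)\in L^1(0,T)$ for every $x\in\mathbb R^d$. A function $u\in C(\overline{Q_T})$ is a viscosity solution of (1) if $u(0,\cdot)=u_0$ and, for all $a,b\in[0,T]$ with $a<b$, all open balls $B\subset\mathbb R^d$ and all $\phi\in\mathcal C^1([0,T]\times\mathbb R^d)$, $$J_{\hat t-a}[\phi](\hat t,\hat x)+K_{\hat t-a}[u](\hat t,\hat x)+H(\hat t,\hat x,u(\hat t,\hat x),D\phi(\hat t,\hat x))\le 0\quad(\text{resp. }\ge 0)$$ whenever $u-\phi$ attains its maximum (resp. minimum) over $[a,b]\times\overline B$ at a point $(\hat t,\hat x)\in(a,b]\times B$. Assume that * $H:\overline{Q_T}\times\mathbb R\times\mathbb R^d\to\mathbb R$ is continuous; * $r\mapsto H(t,x,r,p)$ is nondecreasing for all $(t,x,p)\in[0,T]\times\mathbb T^d\times\mathbb R^d$; * $u_0:\mathbb T^d\to\mathbb R$ is Lipschitz continuous, with (least) Lipschitz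 constant $\mathrm{Lip}[u_0]$; * there are constants $L_1\ge 0$ and $L_2>0$ such that $$|H(t,x,r,p)-H(t,y,r,p)|\le L_1|x-y|+L_2|x-y||p|$$ for all $(t,x,y,r,p)\in(0,T]\times\mathbb R^d\times\mathbb R^d\times\mathbb R\times\mathbb R^d$. Let $u\in C(\overline{Q_T})$ be a viscosity solution of (1). Then $|u(t,x)-u(t,y)|\le L(t)|x-y|$ for all $(t,x,y)\in[0,T]\times\mathbb R^d\times\mathbb R^d$, where $$L(t)=\Bigl(\mathrm{Lip}[u_0]+\frac{L_1}{L_2}\Bigr)E_\alpha(L_2t^\alpha)-\frac{L_1}{L_2},\qquad E_\alpha(z)=\sum_{j=0}^\infty\frac{z^j}{\Gamma(j\alpha+1)}.$$ -/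

import Mathlib

open Set MeasureTheory
open scoped NNReal

namespace FracHJ

/-- The Euclidean space `ℝ^d`. -/
abbrev E (d : ℕ) : Type := EuclideanSpace ℝ (Fin d)

/-- `ℤ^d`-periodicity: a function on the torus `𝕋^d = ℝ^d / ℤ^d` is regarded as a
`ℤ^d`-periodic function on `ℝ^d`. -/
def IsPeriodic {d : ℕ} (v : E d → ℝ) : Prop :=
  ∀ (x : E d) (z : Fin d → ℤ), v (x + WithLp.toLp 2 (fun i => (z i : ℝ))) = v x

/-- The closed space-time region `[0,T] × ℝ^d`. -/
def closedQ (d : ℕ) (T : ℝ) : Set (ℝ × E d) := Icc 0 T ×ˢ univ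

/-- The test function class `𝒞¹([0,T] × ℝ^d)`: continuous on `[0,T] × ℝ^d`, of class `C¹` on
`(0,T] × ℝ^d`, and `∂_t φ(·,x) ∈ L¹(0,T)` for every `x`. -/
structure IsTestFunction {d : ℕ} (T : ℝ) (φ : ℝ → E d → ℝ) : Prop where
  continuousOn : ContinuousOn (fun q : ℝ × E d => φ q.1 q.2) (closedQ d T)
  contDiffOn : ContDiffOn ℝ 1 (fun q : ℝ × E d => φ q.1 q.2) (Ioc 0 T ×ˢ univ)
  integrable_dt : ∀ x : E d, IntegrableOn (fun t => deriv (fun s => φ s x) t) (Ioo 0 T)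

/-- `J_r[f](t) = α / Γ(1-α) * ∫_0^r (f(t) - f(t-τ)) τ^{-α-1} dτ`. -/
noncomputable def J (α r : ℝ) (f : ℝ → ℝ) (t : ℝ) : ℝ :=
  α / Real.Gamma (1 - α) * ∫ τ in (0 : ℝ)..r, (f t - f (t - τ)) / τ ^ (α + 1)

/-- `K_r[f](t) = (f(t) - f(0)) / (t^α Γ(1-α)) + α / Γ(1-α) * ∫_r^t (f(t) - f(t-τ)) τ^{-α-1} dτ`. -/
noncomputable def K (α r : ℝ) (f : ℝ → ℝ) (t : ℝ) : ℝ :=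
  (f t - f 0) / (t ^ α * Real.Gamma (1 - α)) +
    α / Real.Gamma (1 - α) * ∫ τ in r..t, (f t - f (t - τ)) / τ ^ (α + 1)

/-- Finiteness of the integral in `K_r[f](t)`. (Automatic for continuous `f` and `0 < r ≤ t`; for
semicontinuous `f` the integral may be infinite, and then the viscosity inequality fails.) -/
def KFinite (α r : ℝ) (f : ℝ → ℝ) (t : ℝ) : Prop :=
  IntervalIntegrable (fun τ => (f t - f (t - τ)) / τ ^ (α + 1)) volume r t

/-- Viscosity subsolutions of `∂_t^α u + H(t,x,u,Du) = 0` in `(0,T] × 𝕋^d`. -/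
structure IsSubsolution {d : ℕ} (α T : ℝ) (H : ℝ → E d → ℝ → E d → ℝ) (u : ℝ → E d → ℝ) :
    Prop where
  periodic : ∀ t ∈ Icc 0 T, IsPeriodic (u t)
  usc : UpperSemicontinuousOn (fun q : ℝ × E d => u q.1 q.2) (closedQ d T)
  ineq : ∀ φ : ℝ → E d → ℝ, IsTestFunction T φ →
    ∀ a ∈ Icc 0 T, ∀ b ∈ Icc 0 T, a < b → ∀ (c : E d) (ρ : ℝ), 0 < ρ →
    ∀ t ∈ Ioc a b, ∀ x ∈ Metric.ball c ρ,
      IsMaxOn (fun q : ℝ × E d => u q.1 q.2 - φ q.1 q.2) (Icc a b ×ˢ Metric.closedBall c ρ) (t, x) →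
      KFinite α (t - a) (fun s => u s x) t ∧
      J α (t - a) (fun s => φ s x) t + K α (t - a) (fun s => u s x) t
        + H t x (u t x) (gradient (φ t) x) ≤ 0

/-- Viscosity supersolutions of `∂_t^α u + H(t,x,u,Du) = 0` in `(0,T] × 𝕋^d`. -/
structure IsSupersolution {d : ℕ} (α T : ℝ) (H : ℝ → E d → ℝ → E d → ℝ) (u : ℝ → E d → ℝ) :
    Prop where
  periodic : ∀ t ∈ Icc 0 T, IsPeriodic (u t)
  lsc : LowerSemicontinuousOn (fun q : ℝ × E d => u q.1 q.2) (closedQ d T)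
  ineq : ∀ φ : ℝ → E d → ℝ, IsTestFunction T φ →
    ∀ a ∈ Icc 0 T, ∀ b ∈ Icc 0 T, a < b → ∀ (c : E d) (ρ : ℝ), 0 < ρ →
    ∀ t ∈ Ioc a b, ∀ x ∈ Metric.ball c ρ,
      IsMinOn (fun q : ℝ × E d => u q.1 q.2 - φ q.1 q.2) (Icc a b ×ˢ Metric.closedBall c ρ) (t, x) →
      KFinite α (t - a) (fun s => u s x) t ∧
      0 ≤ J α (t - a) (fun s => φ s x) t + K α (t - a) (fun s => u s x) t
        + H t x (u t x) (gradient (φ t) x)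

/-- Viscosity solutions `u ∈ C([0,T] × 𝕋^d)` of the initial value problem
`∂_t^α u + H(t,x,u,Du) = 0` in `(0,T] × 𝕋^d`, `u(0,·) = u₀`. -/
structure IsSolutionIVP {d : ℕ} (α T : ℝ) (H : ℝ → E d → ℝ → E d → ℝ) (u₀ : E d → ℝ)
    (u : ℝ → E d → ℝ) : Prop where
  continuousOn : ContinuousOn (fun q : ℝ × E d => u q.1 q.2) (closedQ d T)
  sub : IsSubsolution α T H u
  super : IsSupersolution α T H u
  initial : ∀ x, u 0 x = u₀ x

/-- The (least) Lipschitz constant `Lip[f]` of a Lipschitz continuous function. -/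
noncomputable def lip {d : ℕ} (f : E d → ℝ) : ℝ≥0 := sInf {C : ℝ≥0 | LipschitzWith C f}

/-- The infimum defining `Lip[f]` is attained. -/
theorem lipschitzWith_lip {d : ℕ} {f : E d → ℝ} (hf : ∃ C : ℝ≥0, LipschitzWith C f) :
    LipschitzWith (lip f) f := by
  have hcl : IsClosed {C : ℝ≥0 | LipschitzWith C f} := by
    have h : {C : ℝ≥0 | LipschitzWith C f}
        = ⋂ x : E d, ⋂ y : E d, {C : ℝ≥0 | dist (f x) (f y) ≤ C * dist x y} := by
      ext C
      simp [lipschitzWith_iff_dist_le_mul]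
    rw [h]
    refine isClosed_iInter fun x => isClosed_iInter fun y => ?_
    exact isClosed_le continuous_const (by fun_prop)
  exact hcl.csInf_mem hf (OrderBot.bddBelow _)

/-- The Mittag-Leffler function `E_α(z) = ∑_{j ≥ 0} z^j / Γ(jα + 1)`. -/
noncomputable def mittagLeffler (α z : ℝ) : ℝ := ∑' j : ℕ, z ^ j / Real.Gamma (j * α + 1)

end FracHJ

namespace FracHJ

open Filter Topology

/-! Freezing a function at its initial value for negative times turns the Caputo derivative into one
integral over τ in (0,∞), with integrand (f(t) - f((t-τ)⁺)) τ^(-α-1). In this form the derivatives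
of u at two different times t and s can be compared for the same τ. Let M be a strict supersolution
of the linear equation, i.e. its Caputo derivative is at least L₂M + L₁ + κ with κ > 0, and let ψ be
a smoothed norm. If u(t,x) - u(t,y) exceeds M(t)ψ(x-y) somewhere, maximize u(t,x) - u(s,y) -
M(t)ψ(x-y) - k(t-s)². Shifting both times by τ at the maximum does not increase the penalty, so the
integrand of M times ψ is at most the difference of the integrands of u; with the viscosity
inequalities this bounds the Caputo derivative of M times ψ by a difference of Hamiltonians with a
common momentum (`caputo_mul_smoothNorm_le`). The smoothing parameter η is fixed, so momenta stay
bounded and k → ∞ needs only continuity of H. Monotonicity and the structure condition then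
contradict κ > 0 (`sub_le_mul_smoothNorm`). The viscosity inequalities hold in Caputo form because a
one-sided touching test function forces the singular integral of u to converge
(`caputo_add_le_zero`). For M one takes A S - L₁/L₂ with S a partial sum of E_α(l t^α) and l > L₂:
differentiation loses only the top term of the sum, which is negligible for many terms
(`exists_lt_caputo_mlSum`). Partial sums lie below the full series, and l → L₂ gives L(t). -/

/-! ### The Caputo derivative as an integral over the half-line -/

/-- The integrand of the Caputo derivative, with `f` frozen at its initial value for negative
times. -/
noncomputable def caputoIntegrand (α : ℝ) (f : ℝ → ℝ) (t τ : ℝ) : ℝ :=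
  (f t - f (max (t - τ) 0)) / τ ^ (α + 1)

/-- The Caputo derivative of order `α` in the form
`α / Γ(1-α) * ∫_0^∞ (f(t) - f((t-τ)⁺)) τ^{-α-1} dτ`. -/
noncomputable def caputo (α : ℝ) (f : ℝ → ℝ) (t : ℝ) : ℝ :=
  α / Real.Gamma (1 - α) * ∫ τ in Ioi (0 : ℝ), caputoIntegrand α f t τ

theorem integral_rpow_mul_sub_rpow {s q a : ℝ} (hs : 0 < s) (hq : 0 < q) (ha : 0 < a) :
    ∫ x in (0 : ℝ)..a, x ^ (s - 1) * (a - x) ^ (q - 1) =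
      a ^ (s + q - 1) * (Real.Gamma s * Real.Gamma q / Real.Gamma (s + q)) := by
  have h := Complex.betaIntegral_scaled s q ha
  have h1 : ∫ x in (0 : ℝ)..a, (x : ℂ) ^ ((s : ℂ) - 1) * ((a : ℂ) - x) ^ ((q : ℂ) - 1) =
      ((∫ x in (0 : ℝ)..a, x ^ (s - 1) * (a - x) ^ (q - 1) : ℝ) : ℂ) := by
    rw [← intervalIntegral.integral_ofReal]
    refine intervalIntegral.integral_congr fun x hx => ?_
    rw [uIcc_of_le ha.le] at hx
    rw [Complex.ofReal_mul, Complex.ofReal_cpow hx.1, Complex.ofReal_cpow (sub_nonneg.2 hx.2)]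
    push_cast
    rfl
  rw [h1, Complex.betaIntegral_eq_Gamma_mul_div _ _ (by simpa) (by simpa)] at h
  have h2 : (a : ℂ) ^ ((s : ℂ) + q - 1) = ((a ^ (s + q - 1) : ℝ) : ℂ) := by
    rw [Complex.ofReal_cpow ha.le]
    push_cast
    rfl
  rw [h2, ← Complex.ofReal_add, Complex.Gamma_ofReal, Complex.Gamma_ofReal,
    Complex.Gamma_ofReal] at h
  exact_mod_cast h

/-- A nonintegrable function has integral 0 by convention, whereas the Beta value is positive. -/
theorem intervalIntegrable_rpow_mul_sub_rpow {s q a : ℝ} (hs : 0 < s) (hq : 0 < q) (ha : 0 < a) :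
    IntervalIntegrable (fun x => x ^ (s - 1) * (a - x) ^ (q - 1)) volume 0 a := by
  by_contra h
  have h0 := intervalIntegral.integral_undef h
  rw [integral_rpow_mul_sub_rpow hs hq ha] at h0
  have := Real.Gamma_pos_of_pos hs
  have := Real.Gamma_pos_of_pos hq
  have := Real.Gamma_pos_of_pos (add_pos hs hq)
  have : 0 < a ^ (s + q - 1) := Real.rpow_pos_of_pos ha _
  exact absurd h0 (by positivity)

/-- Bernoulli's inequality for β ≥ 1, and s ≤ s^β on [0,1] for β ≤ 1. The bound is linear in τ up to
τ = t, so the Caputo integrand of a power is O(τ^(-α)). -/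
theorem rpow_sub_rpow_sub_le {β t τ : ℝ} (ht : 0 < t) (h0 : 0 ≤ τ) (hτ : τ ≤ t) :
    t ^ β - (t - τ) ^ β ≤ max 1 β * t ^ (β - 1) * τ := by
  have hs : 0 ≤ τ / t := by positivity
  have hs1 : τ / t ≤ 1 := (div_le_one ht).2 hτ
  have key : 1 - max 1 β * (τ / t) ≤ (1 - τ / t) ^ β := by
    rcases le_total 1 β with h | h
    · rw [max_eq_right h]
      have := one_add_mul_self_le_rpow_one_add (s := -(τ / t)) (by linarith) h
      rw [← sub_eq_add_neg] at this
      linarith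
    · rw [max_eq_left h, one_mul]
      exact Real.self_le_rpow_of_le_one (by linarith) (by linarith) h
  have e1 : t - τ = t * (1 - τ / t) := by field_simp
  rw [e1, Real.mul_rpow ht.le (by linarith), Real.rpow_sub_one ht.ne']
  have := mul_le_mul_of_nonneg_left key (Real.rpow_nonneg ht.le β)
  have e2 : max 1 β * (t ^ β / t) * τ = t ^ β * (max 1 β * (τ / t)) := by ring
  rw [e2]
  linarith

theorem caputoIntegrand_eq_rpow_of_le {α : ℝ} {f : ℝ → ℝ} {t τ : ℝ} (h0 : 0 < τ) (h : t ≤ τ) :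
    caputoIntegrand α f t τ = (f t - f 0) * τ ^ (-(α + 1)) := by
  rw [caputoIntegrand, max_eq_right (by linarith), Real.rpow_neg h0.le, div_eq_mul_inv]

theorem integrableOn_caputoIntegrand_Ioi {α : ℝ} (hα : 0 < α) (f : ℝ → ℝ) {t : ℝ} (ht : 0 < t) :
    IntegrableOn (caputoIntegrand α f t) (Ioi t) := by
  have := (integrableOn_Ioi_rpow_of_lt (a := -(α + 1)) (by linarith) ht).const_mul (f t - f 0)
  refine IntegrableOn.congr_fun this (fun τ hτ => ?_) measurableSet_Ioi
  exact (caputoIntegrand_eq_rpow_of_le (ht.trans hτ) hτ.le).symm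

/-- After multiplication by α / Γ(1-α), this tail is the boundary term (f(t) - f(0)) / (t^α Γ(1-α))
of `K`. -/
theorem integral_caputoIntegrand_Ioi {α : ℝ} (hα : 0 < α) (f : ℝ → ℝ) {t : ℝ} (ht : 0 < t) :
    ∫ τ in Ioi t, caputoIntegrand α f t τ = (f t - f 0) * (t ^ (-α) / α) := by
  rw [setIntegral_congr_fun measurableSet_Ioi (fun τ (hτ : t < τ) =>
    caputoIntegrand_eq_rpow_of_le (α := α) (f := f) (ht.trans hτ) hτ.le),
    integral_const_mul, integral_Ioi_rpow_of_lt (by linarith) ht]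
  congr 1
  rw [show -(α + 1) + 1 = -α by ring, neg_div_neg_eq]

theorem measurable_caputoIntegrand_rpow (α β t : ℝ) :
    Measurable (caputoIntegrand α (fun s => s ^ β) t) := by
  unfold caputoIntegrand
  fun_prop

theorem intervalIntegrable_caputoIntegrand_rpow {α β t : ℝ} (hα : α ∈ Ioo (0 : ℝ) 1) (hβ : 0 < β)
    (ht : 0 < t) :
    IntervalIntegrable (caputoIntegrand α (fun s => s ^ β) t) volume 0 t := by
  have h := (intervalIntegral.intervalIntegrable_rpow' (a := 0) (b := t) (r := -α)
    (by linarith [hα.2])).const_mul (max 1 β * t ^ (β - 1))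
  rw [intervalIntegrable_iff_integrableOn_Ioc_of_le ht.le] at h ⊢
  refine Integrable.mono' h (measurable_caputoIntegrand_rpow α β t).aestronglyMeasurable ?_
  refine (ae_restrict_iff' measurableSet_Ioc).2 (ae_of_all _ fun τ hτ => ?_)
  have hm := rpow_sub_rpow_sub_le (β := β) ht hτ.1.le hτ.2
  have hp : 0 < τ ^ (α + 1) := Real.rpow_pos_of_pos hτ.1 _
  have hnn : 0 ≤ t ^ β - (t - τ) ^ β :=
    sub_nonneg.2 (Real.rpow_le_rpow (by linarith [hτ.2]) (by linarith [hτ.1]) hβ.le)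
  rw [caputoIntegrand, max_eq_left (by linarith [hτ.2]),
    Real.norm_of_nonneg (div_nonneg hnn hp.le), div_le_iff₀ hp, mul_assoc,
    ← Real.rpow_add hτ.1, show -α + (α + 1) = 1 by ring, Real.rpow_one]
  exact hm

theorem integrableOn_caputoIntegrand_of_intervalIntegrable {α t : ℝ} {f : ℝ → ℝ} (hα : 0 < α)
    (ht : 0 < t) (h : IntervalIntegrable (caputoIntegrand α f t) volume 0 t) :
    IntegrableOn (caputoIntegrand α f t) (Ioi 0) := by
  rw [intervalIntegrable_iff_integrableOn_Ioc_of_le ht.le] at h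
  rw [← Ioc_union_Ioi_eq_Ioi ht.le]
  exact h.union (integrableOn_caputoIntegrand_Ioi hα f ht)

theorem integral_caputoIntegrand_eq_add {α r : ℝ} {f : ℝ → ℝ} {t : ℝ} (hα : 0 < α)
    (hr : r ≤ t) (ht : 0 < t) (h : IntervalIntegrable (caputoIntegrand α f t) volume r t) :
    ∫ τ in Ioi r, caputoIntegrand α f t τ =
      (∫ τ in r..t, caputoIntegrand α f t τ) + (f t - f 0) * (t ^ (-α) / α) := by
  rw [← integral_caputoIntegrand_Ioi hα f ht, intervalIntegral.integral_of_le hr,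
    ← setIntegral_union (Ioc_disjoint_Ioi le_rfl) measurableSet_Ioi
      ((intervalIntegrable_iff_integrableOn_Ioc_of_le hr).1 h)
      (integrableOn_caputoIntegrand_Ioi hα f ht), Ioc_union_Ioi_eq_Ioi hr]

/-- Integration by parts with F(τ) = (t^β - (t-τ)^β) τ^(-α). The boundary value at 0 vanishes
because F = O(τ^(1-α)); the one at t is t^(β-α). What remains is a Beta integral. -/
theorem integral_caputoIntegrand_rpow {α β t : ℝ} (hα : α ∈ Ioo (0 : ℝ) 1) (hβ : 0 < β)
    (ht : 0 < t) :
    α * ∫ τ in (0 : ℝ)..t, caputoIntegrand α (fun s => s ^ β) t τ =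
      β * (∫ τ in (0 : ℝ)..t, τ ^ ((1 - α) - 1) * (t - τ) ^ (β - 1)) - t ^ (β - α) := by
  have hi1 := (intervalIntegrable_rpow_mul_sub_rpow (s := 1 - α) (by linarith [hα.2]) hβ
    ht).const_mul β
  have hi2 := (intervalIntegrable_caputoIntegrand_rpow hα hβ ht).const_mul α
  set F : ℝ → ℝ := fun τ => (t ^ β - (t - τ) ^ β) * τ ^ (-α)
  have hderiv : ∀ τ ∈ Ioo (0 : ℝ) t, HasDerivAt F
      (β * (τ ^ ((1 - α) - 1) * (t - τ) ^ (β - 1))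
        - α * caputoIntegrand α (fun s => s ^ β) t τ) τ := by
    intro τ hτ
    have h1 : HasDerivAt (fun τ => (t - τ) ^ β) (-1 * β * (t - τ) ^ (β - 1)) τ :=
      ((hasDerivAt_id τ).const_sub t).rpow_const (Or.inl (by
        have := hτ.2
        simp only [id]
        linarith))
    have h2 : HasDerivAt (fun τ : ℝ => τ ^ (-α)) (-α * τ ^ (-α - 1)) τ :=
      Real.hasDerivAt_rpow_const (Or.inl hτ.1.ne')
    refine ((h1.const_sub (t ^ β)).mul h2).congr_deriv ?_
    rw [caputoIntegrand, max_eq_left (by linarith [hτ.2]), div_eq_mul_inv,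
      ← Real.rpow_neg hτ.1.le, show -(α + 1) = -α - 1 by ring, show (1 - α) - 1 = -α by ring]
    ring
  have hb : ∀ τ ∈ Ioo (0 : ℝ) t, F τ ≤ max 1 β * t ^ (β - 1) * τ ^ (1 - α) := by
    intro τ hτ
    have := mul_le_mul_of_nonneg_right (rpow_sub_rpow_sub_le (β := β) ht hτ.1.le hτ.2.le)
      (Real.rpow_nonneg hτ.1.le (-α))
    rwa [mul_assoc _ τ, ← Real.rpow_one_add' hτ.1.le (by linarith [hα.2]),
      ← sub_eq_add_neg] at this
  have hn : ∀ τ ∈ Ioo (0 : ℝ) t, 0 ≤ F τ := fun τ hτ =>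
    mul_nonneg (sub_nonneg.2 (Real.rpow_le_rpow (by linarith [hτ.2]) (by linarith [hτ.1]) hβ.le))
      (Real.rpow_nonneg hτ.1.le _)
  have hmem : Ioo 0 t ∈ 𝓝[>] (0 : ℝ) := Ioo_mem_nhdsGT ht
  have hlim0 : Tendsto F (𝓝[>] 0) (𝓝 0) := by
    have hc : Tendsto (fun τ : ℝ => max 1 β * t ^ (β - 1) * τ ^ (1 - α)) (𝓝[>] 0) (𝓝 0) := by
      have : ContinuousAt (fun τ : ℝ => max 1 β * t ^ (β - 1) * τ ^ (1 - α)) 0 :=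
        continuousAt_const.mul (Real.continuousAt_rpow_const 0 (1 - α) (Or.inr (by linarith [hα.2])))
      have h := this.tendsto
      simp only [Real.zero_rpow (show 1 - α ≠ 0 by linarith [hα.2]), mul_zero] at h
      exact h.mono_left nhdsWithin_le_nhds
    exact tendsto_of_tendsto_of_tendsto_of_le_of_le' tendsto_const_nhds hc
      (eventually_of_mem hmem hn) (eventually_of_mem hmem hb)
  have hlimt : Tendsto F (𝓝[<] t) (𝓝 (t ^ (β - α))) := by
    have hc : ContinuousAt F t := by
      refine ContinuousAt.mul ?_ (Real.continuousAt_rpow_const t (-α) (Or.inl ht.ne'))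
      exact continuousAt_const.sub
        ((continuousAt_const.sub continuousAt_id).rpow_const (Or.inr hβ.le))
    have h := hc.tendsto.mono_left (nhdsWithin_le_nhds (s := Iio t))
    have e : F t = t ^ (β - α) := by
      simp only [F, sub_self, Real.zero_rpow hβ.ne', sub_zero]
      rw [← Real.rpow_add ht, ← sub_eq_add_neg]
    rwa [e] at h
  have h := intervalIntegral.integral_eq_sub_of_hasDerivAt_of_tendsto ht hderiv (hi1.sub hi2)
    hlim0 hlimt
  rw [intervalIntegral.integral_sub hi1 hi2, intervalIntegral.integral_const_mul,
    intervalIntegral.integral_const_mul] at h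
  linarith

/-- The Caputo derivative of a power. -/
theorem caputo_rpow {α β t : ℝ} (hα : α ∈ Ioo (0 : ℝ) 1) (hβ : 0 < β) (ht : 0 < t) :
    caputo α (fun s => s ^ β) t =
      Real.Gamma (β + 1) / Real.Gamma (β - α + 1) * t ^ (β - α) := by
  have hα1 : 0 < 1 - α := by linarith [hα.2]
  have hα0 := hα.1
  have hG := Real.Gamma_pos_of_pos hα1
  have hG2 : 0 < Real.Gamma (β - α + 1) := Real.Gamma_pos_of_pos (by linarith)
  have h1 := integral_caputoIntegrand_rpow hα hβ ht
  rw [integral_rpow_mul_sub_rpow hα1 hβ ht] at h1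
  rw [caputo, integral_caputoIntegrand_eq_add hα0 ht.le ht
    (intervalIntegrable_caputoIntegrand_rpow hα hβ ht)]
  have e : t ^ β * t ^ (-α) = t ^ (β - α) := by rw [← Real.rpow_add ht, sub_eq_add_neg]
  simp only [Real.zero_rpow hβ.ne', sub_zero]
  rw [Real.Gamma_add_one hβ.ne', show β - α + 1 = 1 - α + β by ring] at *
  rw [show 1 - α + β - 1 = β - α by ring] at h1
  set I := ∫ τ in (0 : ℝ)..t, caputoIntegrand α (fun s => s ^ β) t τ
  -- The tail over τ > t cancels the boundary term -t^(β-α) of the integration by parts.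
  have : α * (I + t ^ β * (t ^ (-α) / α)) = α * I + t ^ (β - α) := by
    rw [← e]
    field_simp
  rw [div_mul_eq_mul_div, this, h1]
  field_simp
  ring

theorem integrableOn_caputoIntegrand_rpow {α β t : ℝ} (hα : α ∈ Ioo (0 : ℝ) 1) (hβ : 0 < β)
    (ht : 0 < t) : IntegrableOn (caputoIntegrand α (fun s => s ^ β) t) (Ioi 0) :=
  integrableOn_caputoIntegrand_of_intervalIntegrable hα.1 ht
    (intervalIntegrable_caputoIntegrand_rpow hα hβ ht)

/-! ### The Mittag-Leffler function -/

/-- Euler's integral restricted to x > R, where x^s ≥ R^s. As R is free, Γ(jα+1) outgrows every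
geometric sequence. -/
theorem rpow_mul_exp_neg_le_Gamma {s R : ℝ} (hs : 0 ≤ s) (hR : 0 < R) :
    R ^ s * Real.exp (-R) ≤ Real.Gamma (s + 1) := by
  have hi := Real.GammaIntegral_convergent (show 0 < s + 1 by linarith)
  rw [Real.Gamma_eq_integral (by linarith)]
  simp only [add_sub_cancel_right] at hi ⊢
  have hle : Ioi R ⊆ Ioi 0 := Ioi_subset_Ioi hR.le
  calc R ^ s * Real.exp (-R) = ∫ x in Ioi R, R ^ s * Real.exp (-x) := by
        rw [integral_const_mul, integral_exp_neg_Ioi]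
    _ ≤ ∫ x in Ioi R, Real.exp (-x) * x ^ s := by
        refine setIntegral_mono_on ((integrableOn_exp_neg_Ioi R).const_mul _)
          (hi.mono_set hle) measurableSet_Ioi fun x hx => ?_
        rw [mul_comm]
        exact mul_le_mul_of_nonneg_left (Real.rpow_le_rpow hR.le (le_of_lt hx) hs)
          (Real.exp_pos _).le
    _ ≤ _ := setIntegral_mono_set hi ((ae_restrict_iff' measurableSet_Ioi).2 (ae_of_all _
          fun x hx => mul_nonneg (Real.exp_pos _).le (Real.rpow_nonneg (le_of_lt hx) _)))
          (LE.le.eventuallyLE hle)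

theorem Gamma_nat_mul_add_one_pos {α : ℝ} (hα : 0 < α) (j : ℕ) :
    0 < Real.Gamma (j * α + 1) := Real.Gamma_pos_of_pos (by positivity)

theorem summable_mittagLeffler {α z : ℝ} (hα : 0 < α) (hz : 0 ≤ z) :
    Summable fun j : ℕ => z ^ j / Real.Gamma (j * α + 1) := by
  -- Chosen so that R^(jα) = (2z+1)^j, which gives the geometric majorant e^R (z/(2z+1))^j.
  set R : ℝ := (2 * z + 1) ^ (α⁻¹)
  have hR : 0 < R := Real.rpow_pos_of_pos (by linarith) _
  have hRα : R ^ α = 2 * z + 1 := Real.rpow_inv_rpow (by linarith) hα.ne'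
  have hq : z / (2 * z + 1) < 1 := (div_lt_one (by linarith)).2 (by linarith)
  refine Summable.of_nonneg_of_le
    (fun j => div_nonneg (pow_nonneg hz j) (Gamma_nat_mul_add_one_pos hα j).le) (fun j => ?_)
    ((summable_geometric_of_lt_one (by positivity) hq).mul_left (Real.exp R))
  have h := rpow_mul_exp_neg_le_Gamma (s := j * α) (by positivity) hR
  rw [mul_comm (j : ℝ), Real.rpow_mul hR.le, hRα, Real.rpow_natCast] at h
  rw [mul_comm (j : ℝ), div_le_iff₀ (by rw [mul_comm]; exact Gamma_nat_mul_add_one_pos hα j),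
    div_pow]
  calc z ^ j = Real.exp R * (z ^ j / (2 * z + 1) ^ j) * ((2 * z + 1) ^ j * Real.exp (-R)) := by
        have : (2 * z + 1) ^ j ≠ 0 := by positivity
        rw [Real.exp_neg]
        field_simp
    _ ≤ _ := mul_le_mul_of_nonneg_left h (by positivity)

theorem continuousOn_mittagLeffler {α : ℝ} (hα : 0 < α) (R : ℝ) (hR : 0 ≤ R) :
    ContinuousOn (mittagLeffler α) (Icc 0 R) := by
  refine continuousOn_tsum (fun j => (continuous_pow j).continuousOn.div_const _)
    (summable_mittagLeffler hα hR) fun j z hz => ?_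
  rw [Real.norm_of_nonneg (div_nonneg (pow_nonneg hz.1 j) (Gamma_nat_mul_add_one_pos hα j).le)]
  exact div_le_div_of_nonneg_right (pow_le_pow_left₀ hz.1 hz.2 j)
    (Gamma_nat_mul_add_one_pos hα j).le

/-- Partial sums of `E_α(λ t^α)`. -/
noncomputable def mlSum (α l : ℝ) (N : ℕ) (t : ℝ) : ℝ :=
  ∑ j ∈ Finset.range N, l ^ j / Real.Gamma (j * α + 1) * t ^ (j * α)

theorem mlSum_le_mittagLeffler {α l t : ℝ} (hα : 0 < α) (hl : 0 ≤ l) (ht : 0 ≤ t) (N : ℕ) :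
    mlSum α l N t ≤ mittagLeffler α (l * t ^ α) := by
  have hz : 0 ≤ l * t ^ α := mul_nonneg hl (Real.rpow_nonneg ht _)
  refine le_of_eq_of_le ?_ ((summable_mittagLeffler hα hz).sum_le_tsum (Finset.range N)
    fun j _ => div_nonneg (pow_nonneg hz j) (Gamma_nat_mul_add_one_pos hα j).le)
  refine Finset.sum_congr rfl fun j _ => ?_
  rw [mul_pow, mul_comm (j : ℝ) α, Real.rpow_mul ht, Real.rpow_natCast]
  ring

theorem caputoIntegrand_sum_mul {ι : Type*} (α : ℝ) (s : Finset ι) (c : ι → ℝ) (f : ι → ℝ → ℝ)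
    (b t τ : ℝ) :
    caputoIntegrand α (fun t => ∑ i ∈ s, c i * f i t - b) t τ =
      ∑ i ∈ s, c i * caputoIntegrand α (f i) t τ := by
  simp only [caputoIntegrand]
  rw [sub_sub_sub_cancel_right, ← Finset.sum_sub_distrib, Finset.sum_div]
  refine Finset.sum_congr rfl fun i _ => ?_
  ring

/-- The Caputo integrand of a constant vanishes, so a power with exponent `0` is allowed. -/
theorem integrableOn_caputoIntegrand_nat_mul {α t : ℝ} (hα : α ∈ Ioo (0 : ℝ) 1) (ht : 0 < t)
    (j : ℕ) : IntegrableOn (caputoIntegrand α (fun s => s ^ (j * α)) t) (Ioi 0) := by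
  rcases Nat.eq_zero_or_pos j with rfl | hj
  · have : caputoIntegrand α (fun s => s ^ (((0 : ℕ) : ℝ) * α)) t = fun _ => 0 := by
      ext τ
      simp [caputoIntegrand]
    rw [this]
    exact integrableOn_zero
  · exact integrableOn_caputoIntegrand_rpow hα (mul_pos (by exact_mod_cast hj) hα.1) ht

theorem integrableOn_caputoIntegrand_mlSum {α l A B t : ℝ} (hα : α ∈ Ioo (0 : ℝ) 1) (ht : 0 < t)
    (N : ℕ) :
    IntegrableOn (caputoIntegrand α (fun s => A * mlSum α l N s - B) t) (Ioi 0) := by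
  have : caputoIntegrand α (fun s => A * mlSum α l N s - B) t = fun τ =>
      ∑ j ∈ Finset.range N, (A * (l ^ j / Real.Gamma (j * α + 1))) *
        caputoIntegrand α (fun s => s ^ (j * α)) t τ := by
    ext τ
    rw [← caputoIntegrand_sum_mul (b := B)]
    simp only [mlSum, Finset.mul_sum, mul_assoc]
  rw [this]
  exact integrable_finsetSum _ fun j _ =>
    (integrableOn_caputoIntegrand_nat_mul hα ht j).const_mul _

/-- The Gamma quotient of `caputo_rpow` turns the coefficient of index j+1 into l times that of
index j, and constants vanish. The sum is thus reproduced up to the factor l, with its top term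
missing. -/
theorem caputo_mlSum {α l A B t : ℝ} (hα : α ∈ Ioo (0 : ℝ) 1) (ht : 0 < t) (N : ℕ) :
    caputo α (fun s => A * mlSum α l (N + 1) s - B) t = A * l * mlSum α l N t := by
  have h1 : ∀ τ, caputoIntegrand α (fun s => A * mlSum α l (N + 1) s - B) t τ =
      ∑ j ∈ Finset.range (N + 1), (A * (l ^ j / Real.Gamma (j * α + 1))) *
        caputoIntegrand α (fun s => s ^ (j * α)) t τ := by
    intro τ
    rw [← caputoIntegrand_sum_mul (b := B)]
    simp only [mlSum, Finset.mul_sum, mul_assoc]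
  have h2 : caputo α (fun s => s ^ (((0 : ℕ) : ℝ) * α)) t = 0 := by
    simp [caputo, caputoIntegrand]
  have h3 : ∀ j : ℕ, caputo α (fun s => s ^ (((j + 1 : ℕ) : ℝ) * α)) t =
      Real.Gamma (((j + 1 : ℕ) : ℝ) * α + 1) / Real.Gamma (j * α + 1) * t ^ (j * α) := by
    intro j
    rw [caputo_rpow hα (mul_pos (by positivity) hα.1) ht]
    rw [show ((j + 1 : ℕ) : ℝ) * α - α = j * α by push_cast; ring]
  have h4 : caputo α (fun s => A * mlSum α l (N + 1) s - B) t =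
      ∑ j ∈ Finset.range (N + 1), (A * (l ^ j / Real.Gamma (j * α + 1))) *
        caputo α (fun s => s ^ (j * α)) t := by
    rw [caputo]
    simp_rw [h1]
    rw [integral_finsetSum _ fun j _ =>
      (integrableOn_caputoIntegrand_nat_mul hα ht j).const_mul _, Finset.mul_sum]
    refine Finset.sum_congr rfl fun j _ => ?_
    rw [integral_const_mul, caputo]
    ring
  rw [h4, Finset.sum_range_succ', h2, mul_zero, add_zero, mlSum, Finset.mul_sum]
  refine Finset.sum_congr rfl fun j _ => ?_
  rw [h3]
  have := (Gamma_nat_mul_add_one_pos hα.1 (j + 1)).ne'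
  have := (Gamma_nat_mul_add_one_pos hα.1 j).ne'
  field_simp
  ring

theorem one_le_mlSum {α l t : ℝ} (hα : 0 < α) (hl : 0 ≤ l) (ht : 0 ≤ t) (N : ℕ) :
    1 ≤ mlSum α l (N + 1) t := by
  rw [mlSum, Finset.sum_range_succ']
  simp only [pow_zero, Nat.cast_zero, zero_mul, zero_add, Real.Gamma_one, div_one, Real.rpow_zero,
    mul_one, le_add_iff_nonneg_left]
  exact Finset.sum_nonneg fun j _ => mul_nonneg
    (div_nonneg (pow_nonneg hl _) (Gamma_nat_mul_add_one_pos hα _).le) (Real.rpow_nonneg ht _)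

theorem continuous_mlSum {α l : ℝ} (hα : 0 < α) (N : ℕ) : Continuous (mlSum α l N) :=
  continuous_finsetSum _ fun j _ => continuous_const.mul
    (Real.continuous_rpow_const (by positivity))

theorem contDiffOn_mlSum (α l : ℝ) (N : ℕ) {n : WithTop ℕ∞} : ContDiffOn ℝ n (mlSum α l N) (Ioi 0) :=
  ContDiffOn.sum fun _ _ => contDiffOn_const.mul
    (contDiffOn_id.rpow_const_of_ne fun _ hx => ne_of_gt hx)

/-- The derivative may blow up at 0, but the exponents jα - 1 with j ≥ 1 exceed -1. -/
theorem integrableOn_deriv_mlSum {α l T : ℝ} (hα : 0 < α) (N : ℕ) :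
    IntegrableOn (deriv (mlSum α l N)) (Ioo 0 T) := by
  have hi : IntegrableOn (fun t : ℝ => ∑ j ∈ Finset.range N,
      l ^ j / Real.Gamma (j * α + 1) * (j * α * t ^ (j * α - 1))) (Ioo 0 T) := by
    refine integrable_finsetSum _ fun j _ => Integrable.const_mul ?_ _
    rcases Nat.eq_zero_or_pos j with rfl | hj
    · simp
    · have hj' : 0 < (j : ℝ) * α := mul_pos (by exact_mod_cast hj) hα
      have := (intervalIntegral.intervalIntegrable_rpow' (a := 0) (b := T) (r := j * α - 1)
        (by linarith)).1
      exact (this.mono_set Ioo_subset_Ioc_self).const_mul _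
  refine hi.congr_fun (fun t ht => ?_) measurableSet_Ioo
  refine (HasDerivAt.deriv ?_).symm
  refine HasDerivAt.fun_sum fun j _ => ?_
  exact (Real.hasDerivAt_rpow_const (Or.inl ht.1.ne')).const_mul _

/-- A large partial sum is a strict supersolution of the linear fractional equation. -/
theorem exists_lt_caputo_mlSum {α T L₁ L₂ l A : ℝ} (hα : α ∈ Ioo (0 : ℝ) 1) (hT : 0 < T)
    (hL₂ : 0 < L₂) (hl : L₂ < l) (hA : 0 < A) :
    ∃ N : ℕ, ∃ κ > 0, ∀ t ∈ Ioc 0 T,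
      L₂ * (A * mlSum α l (N + 1) t - L₁ / L₂) + L₁ + κ ≤
        caputo α (fun s => A * mlSum α l (N + 1) s - L₁ / L₂) t := by
  have hl0 : 0 < l := hL₂.trans hl
  have hlim := (summable_mittagLeffler (z := l * T ^ α) hα.1
    (by positivity)).tendsto_atTop_zero
  -- The missing top term, largest at t = T, costs at most (l - L₂)/2 after multiplication by l. The
  -- gain (l - L₂)S is at least l - L₂ because S ≥ 1, so half of it is left for κ.
  obtain ⟨N, hN⟩ := (hlim.eventually_lt_const (show 0 < (l - L₂) / (2 * l) by
    have : 0 < l - L₂ := by linarith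
    positivity)).exists
  refine ⟨N, A * ((l - L₂) / 2), mul_pos hA (by linarith), fun t ht => ?_⟩
  rw [caputo_mlSum hα ht.1]
  have hS := one_le_mlSum hα.1 hl0.le ht.1.le N (l := l)
  have hsucc : mlSum α l (N + 1) t =
      mlSum α l N t + l ^ N / Real.Gamma (N * α + 1) * t ^ (N * α) := by
    rw [mlSum, Finset.sum_range_succ, mlSum]
  have hq : l ^ N / Real.Gamma (N * α + 1) * t ^ (N * α) ≤ (l - L₂) / (2 * l) := by
    refine le_trans ?_ hN.le
    rw [mul_pow, ← Real.rpow_natCast (T ^ α), ← Real.rpow_mul hT.le, mul_comm α, mul_div_right_comm]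
    exact mul_le_mul_of_nonneg_left
      (Real.rpow_le_rpow ht.1.le ht.2 (mul_nonneg N.cast_nonneg hα.1.le))
      (div_nonneg (by positivity) (Gamma_nat_mul_add_one_pos hα.1 N).le)
  set q := l ^ N / Real.Gamma (N * α + 1) * t ^ (N * α)
  set S := mlSum α l (N + 1) t
  have e1 : L₂ * (A * S - L₁ / L₂) + L₁ = A * (L₂ * S) := by
    field_simp
    ring
  rw [e1, mul_assoc, ← mul_add]
  refine mul_le_mul_of_nonneg_left ?_ hA.le
  have e2 : l * q ≤ (l - L₂) / 2 := by
    have := mul_le_mul_of_nonneg_left hq hl0.le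
    rwa [show l * ((l - L₂) / (2 * l)) = (l - L₂) / 2 by field_simp] at this
  have e3 : mlSum α l N t = S - q := by linarith
  rw [e3]
  nlinarith

/-! ### Passing to the limit in the nonlocal viscosity inequality -/

theorem continuousOn_caputoIntegrand {α t r : ℝ} {f : ℝ → ℝ} (hf : ContinuousOn f (Icc 0 t))
    (hr : 0 < r) : ContinuousOn (caputoIntegrand α f t) (Icc r t) := by
  refine ContinuousOn.div (continuousOn_const.sub (hf.comp (by fun_prop) fun τ hτ => ?_))
    (continuousOn_id.rpow_const fun τ hτ => Or.inl (hr.trans_le hτ.1).ne') fun τ hτ =>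
      (Real.rpow_pos_of_pos (hr.trans_le hτ.1) _).ne'
  exact ⟨le_max_right _ _, max_le (by linarith [hτ.1]) (by linarith [hτ.1, hτ.2])⟩

theorem intervalIntegrable_caputoIntegrand {α t r : ℝ} {f : ℝ → ℝ}
    (hf : ContinuousOn f (Icc 0 t)) (hr : 0 < r) (hrt : r ≤ t) :
    IntervalIntegrable (caputoIntegrand α f t) volume r t :=
  (continuousOn_caputoIntegrand hf hr).intervalIntegrable_of_Icc hrt

theorem K_eq_integral_Ioi {α t r : ℝ} {f : ℝ → ℝ} (hα : 0 < α) (hf : ContinuousOn f (Icc 0 t))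
    (hr : 0 < r) (hrt : r ≤ t) :
    K α r f t = α / Real.Gamma (1 - α) * ∫ τ in Ioi r, caputoIntegrand α f t τ := by
  have ht : 0 < t := hr.trans_le hrt
  rw [integral_caputoIntegrand_eq_add hα hrt ht (intervalIntegrable_caputoIntegrand hf hr hrt), K]
  have h1 : ∫ τ in r..t, (f t - f (t - τ)) / τ ^ (α + 1) =
      ∫ τ in r..t, caputoIntegrand α f t τ := by
    refine intervalIntegral.integral_congr fun τ hτ => ?_
    rw [uIcc_of_le hrt] at hτ
    simp only [caputoIntegrand]
    rw [max_eq_left (by linarith [hτ.2])]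
  rw [h1, Real.rpow_neg ht.le]
  have := (Real.rpow_pos_of_pos ht α).ne'
  field_simp
  ring

theorem abs_J_le {α t r C : ℝ} {φ : ℝ → ℝ} (hα : α ∈ Ioo (0 : ℝ) 1) (hr : 0 < r)
    (hφ : ∀ τ ∈ Icc 0 r, |φ t - φ (t - τ)| ≤ C * τ) :
    |J α r φ t| ≤ α / Real.Gamma (1 - α) * (C * (r ^ (1 - α) / (1 - α))) := by
  have hG := Real.Gamma_pos_of_pos (show 0 < 1 - α by linarith [hα.2])
  rw [J, abs_mul, abs_of_pos (div_pos hα.1 hG)]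
  refine mul_le_mul_of_nonneg_left ?_ (div_pos hα.1 hG).le
  have hi : IntervalIntegrable (fun τ : ℝ => C * τ ^ (-α)) volume 0 r :=
    (intervalIntegral.intervalIntegrable_rpow' (by linarith [hα.2])).const_mul C
  have h := intervalIntegral.norm_integral_le_of_norm_le hr.le
    (f := fun τ => (φ t - φ (t - τ)) / τ ^ (α + 1)) (ae_of_all _ fun τ hτ => ?_) hi
  · rw [Real.norm_eq_abs, intervalIntegral.integral_const_mul,
      integral_rpow (Or.inl (by linarith [hα.2])), show -α + 1 = 1 - α by ring,
      Real.zero_rpow (by linarith [hα.2]), sub_zero] at h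
    exact h
  · have hp : 0 < τ ^ (α + 1) := Real.rpow_pos_of_pos hτ.1 _
    rw [norm_div, Real.norm_of_nonneg hp.le, div_le_iff₀ hp, mul_assoc, ← Real.rpow_add hτ.1,
      show -α + (α + 1) = 1 by ring, Real.rpow_one]
    exact hφ τ ⟨hτ.1.le, hτ.2⟩

/-- If the nonlocal inequality with a test function `φ` touching `f` from above at `t` holds for
all small radii, then the Caputo derivative of `f` exists at `t` and satisfies the inequality. -/
theorem caputo_add_le_zero {α t δ C c : ℝ} {f φ : ℝ → ℝ} (hα : α ∈ Ioo (0 : ℝ) 1)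
    (hδ : 0 < δ) (hδt : δ ≤ t) (hf : ContinuousOn f (Icc 0 t))
    (hφ : ∀ τ ∈ Icc 0 δ, |φ t - φ (t - τ)| ≤ C * τ)
    (hle : ∀ τ ∈ Icc 0 δ, φ t - φ (t - τ) ≤ f t - f (t - τ))
    (h : ∀ r ∈ Ioc 0 δ, J α r φ t + K α r f t + c ≤ 0) :
    IntegrableOn (caputoIntegrand α f t) (Ioi 0) ∧ caputo α f t + c ≤ 0 := by
  have hα1 : 0 < 1 - α := by linarith [hα.2]
  have hα0 := hα.1
  have hG := Real.Gamma_pos_of_pos hα1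
  have ht : 0 < t := hδ.trans_le hδt
  have hC : 0 ≤ C := by
    have := (abs_nonneg _).trans (hφ δ ⟨hδ.le, le_rfl⟩)
    exact nonneg_of_mul_nonneg_left this hδ
  set k := α / Real.Gamma (1 - α) with hk
  have hkpos : 0 < k := div_pos hα0 hG
  set g := caputoIntegrand α f t with hg
  have hgint : ∀ r, 0 < r → r ≤ t → IntegrableOn g (Ioi r) := by
    intro r hr hrt
    rw [← Ioc_union_Ioi_eq_Ioi hrt]
    exact ((intervalIntegrable_iff_integrableOn_Ioc_of_le hrt).1
      (intervalIntegrable_caputoIntegrand hf hr hrt)).union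
      (integrableOn_caputoIntegrand_Ioi hα0 f ht)
  -- The `J` term is O(r^(1-α)), so the truncated integrals of f are bounded above uniformly in r.
  have hbound : ∀ r ∈ Ioc 0 δ,
      k * ∫ τ in Ioi r, g τ ≤ k * (C * (r ^ (1 - α) / (1 - α))) - c := by
    intro r hr
    have h1 := h r hr
    have h2 := abs_J_le hα hr.1 fun τ hτ => hφ τ ⟨hτ.1, hτ.2.trans hr.2⟩
    rw [K_eq_integral_Ioi hα0 hf hr.1 (hr.2.trans hδt)] at h1
    linarith [neg_le_of_abs_le h2]
  have hpow : IntegrableOn (fun τ : ℝ => C * τ ^ (-α)) (Ioc 0 δ) :=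
    ((intervalIntegral.intervalIntegrable_rpow' (a := 0) (b := δ) (r := -α)
      (by linarith)).const_mul C).1
  -- The touching condition bounds g below by the integrable function -C τ^(-α).
  have hnonneg : ∀ τ ∈ Ioc 0 δ, 0 ≤ g τ + C * τ ^ (-α) := by
    intro τ hτ
    have hp : 0 < τ ^ (α + 1) := Real.rpow_pos_of_pos hτ.1 _
    have h1 := neg_le_of_abs_le (hφ τ ⟨hτ.1.le, hτ.2⟩)
    have h2 := hle τ ⟨hτ.1.le, hτ.2⟩
    have e : C * τ ^ (-α) = C * τ / τ ^ (α + 1) := by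
      rw [eq_div_iff hp.ne', mul_assoc, ← Real.rpow_add hτ.1, show -α + (α + 1) = 1 by ring,
        Real.rpow_one]
    rw [hg, caputoIntegrand, max_eq_left (by linarith [hτ.2]), e, ← add_div]
    exact div_nonneg (by linarith) hp.le
  set a : ℕ → ℝ := fun n => δ / ((n : ℝ) + 1)
  have ha : ∀ n, a n ∈ Ioc 0 δ := fun n =>
    ⟨by positivity, div_le_self hδ.le (by linarith [n.cast_nonneg (α := ℝ)])⟩
  have ha0 : Tendsto a atTop (𝓝 0) := by
    simpa [a, div_eq_mul_inv] using (tendsto_one_div_add_atTop_nhds_zero_nat (𝕜 := ℝ)).const_mul δ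
  -- For a nonnegative function, a bound on the integrals over (a n, δ] that is uniform in n gives
  -- integrability up to 0.
  have hgδ : IntegrableOn (fun τ => g τ + C * τ ^ (-α)) (Ioc 0 δ) := by
    refine integrableOn_Ioc_of_intervalIntegral_norm_bounded_left
      (I := C * (δ ^ (1 - α) / (1 - α)) - c / k - (∫ τ in Ioi δ, g τ) +
        ∫ τ in Ioc 0 δ, C * τ ^ (-α)) (l := atTop) (a := a) (fun n => ?_) ha0
      (Eventually.of_forall fun n => ?_)
    · exact ((hgint _ (ha n).1 ((ha n).2.trans hδt)).mono_set Ioc_subset_Ioi_self).add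
        (hpow.mono_set (Ioc_subset_Ioc_left (ha n).1.le))
    · have hg1 := hgint _ (ha n).1 ((ha n).2.trans hδt)
      have hsub : Ioc (a n) δ ⊆ Ioc 0 δ := Ioc_subset_Ioc_left (ha n).1.le
      rw [setIntegral_congr_fun measurableSet_Ioc fun τ hτ =>
          Real.norm_of_nonneg (hnonneg τ (hsub hτ)),
        integral_add (hg1.mono_set Ioc_subset_Ioi_self) (hpow.mono_set hsub)]
      have h1 : ∫ τ in Ioi (a n), g τ = (∫ τ in Ioc (a n) δ, g τ) + ∫ τ in Ioi δ, g τ := by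
        rw [← setIntegral_union (Ioc_disjoint_Ioi le_rfl) measurableSet_Ioi
          (hg1.mono_set Ioc_subset_Ioi_self) (hgint δ hδ hδt), Ioc_union_Ioi_eq_Ioi (ha n).2]
      have h2 : ∫ τ in Ioc (a n) δ, C * τ ^ (-α) ≤ ∫ τ in Ioc 0 δ, C * τ ^ (-α) :=
        setIntegral_mono_set hpow ((ae_restrict_iff' measurableSet_Ioc).2 (ae_of_all _
          fun τ hτ => mul_nonneg hC (Real.rpow_nonneg hτ.1.le _))) (LE.le.eventuallyLE hsub)
      have h3 : ∫ τ in Ioi (a n), g τ ≤ C * (a n ^ (1 - α) / (1 - α)) - c / k := by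
        have := hbound _ (ha n)
        rw [← mul_le_mul_iff_right₀ hkpos, mul_sub, mul_div_cancel₀ _ hkpos.ne']
        exact this
      have h4 : C * (a n ^ (1 - α) / (1 - α)) ≤ C * (δ ^ (1 - α) / (1 - α)) := by
        have := Real.rpow_le_rpow (ha n).1.le (ha n).2 hα1.le
        gcongr
      linarith
  have hgI : IntegrableOn g (Ioi 0) := by
    rw [← Ioc_union_Ioi_eq_Ioi hδ.le]
    refine IntegrableOn.union ?_ (hgint δ hδ hδt)
    exact (hgδ.sub hpow).congr_fun (fun τ _ => add_sub_cancel_right _ _) measurableSet_Ioc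
  refine ⟨hgI, ?_⟩
  have hlim : Tendsto (fun n => k * ∫ τ in Ioi (a n), g τ) atTop (𝓝 (k * ∫ τ in Ioi 0, g τ)) := by
    have hU : ⋃ n, Ioi (a n) = Ioi 0 := by
      ext τ
      simp only [mem_iUnion, mem_Ioi]
      refine ⟨fun ⟨n, hn⟩ => (ha n).1.trans hn, fun hτ => (ha0.eventually_lt_const hτ).exists⟩
    have := tendsto_setIntegral_of_monotone (μ := volume) (f := g) (s := fun n => Ioi (a n))
      (fun n => measurableSet_Ioi) (fun m n hmn => Ioi_subset_Ioi (by
        have : (m : ℝ) ≤ n := by exact_mod_cast hmn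
        simp only [a]
        gcongr)) (by rwa [hU])
    rw [hU] at this
    exact this.const_mul k
  have hlim2 : Tendsto (fun n => k * (C * (a n ^ (1 - α) / (1 - α))) - c) atTop (𝓝 (-c)) := by
    have h0 : Tendsto (fun n => a n ^ (1 - α)) atTop (𝓝 0) := by
      have := ha0.rpow_const (p := 1 - α) (Or.inr hα1.le)
      rwa [Real.zero_rpow hα1.ne'] at this
    have := (((h0.div_const (1 - α)).const_mul C).const_mul k).sub_const c
    simpa using this
  have := le_of_tendsto_of_tendsto' hlim hlim2 fun n => hbound _ (ha n)
  rw [caputo, ← hk]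
  linarith

theorem caputoIntegrand_neg (α : ℝ) (f : ℝ → ℝ) (t : ℝ) :
    caputoIntegrand α (fun s => -f s) t = fun τ => -caputoIntegrand α f t τ := by
  ext τ
  simp only [caputoIntegrand]
  ring

theorem caputo_neg (α : ℝ) (f : ℝ → ℝ) (t : ℝ) : caputo α (fun s => -f s) t = -caputo α f t := by
  simp only [caputo, caputoIntegrand_neg, integral_neg, mul_neg]

theorem J_neg (α r : ℝ) (f : ℝ → ℝ) (t : ℝ) : J α r (fun s => -f s) t = -J α r f t := by
  simp only [J]
  rw [← mul_neg, ← intervalIntegral.integral_neg]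
  congr 2
  ext τ
  ring

theorem K_neg (α r : ℝ) (f : ℝ → ℝ) (t : ℝ) : K α r (fun s => -f s) t = -K α r f t := by
  have : (fun τ => (-f t - -f (t - τ)) / τ ^ (α + 1)) =
      fun τ => -((f t - f (t - τ)) / τ ^ (α + 1)) := by
    ext τ
    ring
  simp only [K]
  rw [this, intervalIntegral.integral_neg]
  ring

/-- Only [t/2, t] is used, which stays away from time 0, where the C¹ regularity may fail. -/
theorem exists_abs_sub_le_of_contDiffOn {φ : ℝ → ℝ} {t T : ℝ} (ht : t ∈ Ioc 0 T)
    (hφ : ContDiffOn ℝ 1 φ (Ioc 0 T)) :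
    ∃ C, ∀ τ ∈ Icc 0 (t / 2), |φ t - φ (t - τ)| ≤ C * τ := by
  obtain ⟨C, hC⟩ := (hφ.mono (s := Ioc 0 T) (t := Icc (t / 2) t) fun s hs =>
    ⟨by linarith [hs.1, ht.1], hs.2.trans ht.2⟩).exists_lipschitzOnWith one_ne_zero
    (convex_Icc _ _) isCompact_Icc
  refine ⟨C, fun τ hτ => ?_⟩
  have := hC.dist_le_mul t ⟨by linarith [ht.1], le_rfl⟩ (t - τ)
    ⟨by linarith [hτ.2], by linarith [hτ.1]⟩
  rwa [Real.dist_eq, Real.dist_eq, sub_sub_cancel, abs_of_nonneg hτ.1] at this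

section TestInequalities

variable {d : ℕ} {α T : ℝ} {H : ℝ → E d → ℝ → E d → ℝ} {u φ : ℝ → E d → ℝ}

theorem IsTestFunction.contDiffOn_time (hφ : IsTestFunction T φ) (x : E d) :
    ContDiffOn ℝ 1 (fun s => φ s x) (Ioc 0 T) :=
  hφ.contDiffOn.comp (contDiffOn_id.prodMk contDiffOn_const) fun _ hs => ⟨hs, mem_univ x⟩

theorem continuousOn_time (hu : ContinuousOn (fun q : ℝ × E d => u q.1 q.2) (closedQ d T))
    (x : E d) : ContinuousOn (fun s => u s x) (Icc 0 T) :=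
  hu.comp (continuousOn_id.prodMk continuousOn_const) fun _ hs => ⟨hs, mem_univ x⟩

/-- A global maximum may be tested on [t-r, t] for every small r. As r → 0 the time behaviour of φ
drops out and only its spatial gradient remains. -/
theorem IsSubsolution.caputo_le (hu : IsSubsolution α T H u) (hα : α ∈ Ioo (0 : ℝ) 1)
    (hc : ContinuousOn (fun q : ℝ × E d => u q.1 q.2) (closedQ d T))
    (hφ : IsTestFunction T φ) {t : ℝ} (ht : t ∈ Ioc 0 T) {x : E d}
    (hmax : ∀ s ∈ Icc 0 T, ∀ y, u s y - φ s y ≤ u t x - φ t x) :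
    IntegrableOn (caputoIntegrand α (fun s => u s x) t) (Ioi 0) ∧
      caputo α (fun s => u s x) t + H t x (u t x) (gradient (φ t) x) ≤ 0 := by
  obtain ⟨C, hC⟩ := exists_abs_sub_le_of_contDiffOn ht (hφ.contDiffOn_time x)
  have ht0 := ht.1
  refine caputo_add_le_zero (f := fun s => u s x) (φ := fun s => φ s x) hα (half_pos ht0) (by linarith)
    ((continuousOn_time hc x).mono (Icc_subset_Icc_right ht.2)) hC (fun τ hτ => ?_) fun r hr => ?_
  · have := hmax (t - τ) ⟨by linarith [hτ.2], by linarith [hτ.1, ht.2]⟩ x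
    linarith
  · have := (hu.ineq φ hφ (t - r) ⟨by linarith [hr.2], by linarith [hr.1, ht.2]⟩ t ⟨ht0.le, ht.2⟩
      (by linarith [hr.1]) x 1 one_pos t ⟨by linarith [hr.1], le_rfl⟩ x (Metric.mem_ball_self one_pos)
      (fun q hq => hmax q.1 ⟨by linarith [hq.1.1, hr.2], hq.1.2.trans ht.2⟩ q.2)).2
    rwa [sub_sub_cancel] at this

theorem IsSupersolution.le_caputo (hu : IsSupersolution α T H u) (hα : α ∈ Ioo (0 : ℝ) 1)
    (hc : ContinuousOn (fun q : ℝ × E d => u q.1 q.2) (closedQ d T))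
    (hφ : IsTestFunction T φ) {t : ℝ} (ht : t ∈ Ioc 0 T) {x : E d}
    (hmin : ∀ s ∈ Icc 0 T, ∀ y, u t x - φ t x ≤ u s y - φ s y) :
    IntegrableOn (caputoIntegrand α (fun s => u s x) t) (Ioi 0) ∧
      0 ≤ caputo α (fun s => u s x) t + H t x (u t x) (gradient (φ t) x) := by
  obtain ⟨C, hC⟩ := exists_abs_sub_le_of_contDiffOn ht (hφ.contDiffOn_time x)
  have ht0 := ht.1
  -- The subsolution argument applied to -u, -φ and -H.
  have key := caputo_add_le_zero (f := fun s => -u s x) (φ := fun s => -φ s x) (C := C)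
    (c := -H t x (u t x) (gradient (φ t) x)) hα (half_pos ht0) (by linarith)
    ((continuousOn_time hc x).mono (Icc_subset_Icc_right ht.2)).neg (fun τ hτ => ?_)
    (fun τ hτ => ?_) fun r hr => ?_
  · rw [caputo_neg, caputoIntegrand_neg] at key
    exact ⟨by simpa using key.1.neg, by linarith [key.2]⟩
  · rw [neg_sub_neg, abs_sub_comm]
    exact hC τ hτ
  · have := hmin (t - τ) ⟨by linarith [hτ.2], by linarith [hτ.1, ht.2]⟩ x
    linarith
  · have := (hu.ineq φ hφ (t - r) ⟨by linarith [hr.2], by linarith [hr.1, ht.2]⟩ t ⟨ht0.le, ht.2⟩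
      (by linarith [hr.1]) x 1 one_pos t ⟨by linarith [hr.1], le_rfl⟩ x (Metric.mem_ball_self one_pos)
      (fun q hq => hmin q.1 ⟨by linarith [hq.1.1, hr.2], hq.1.2.trans ht.2⟩ q.2)).2
    rw [sub_sub_cancel] at this
    rw [J_neg, K_neg]
    linarith

end TestInequalities

variable {d : ℕ} {α T : ℝ} {H : ℝ → E d → ℝ → E d → ℝ} {u : ℝ → E d → ℝ}

/-! ### Test functions -/

/-- A smooth approximation of the norm. -/
noncomputable def smoothNorm (η : ℝ) (z : E d) : ℝ := √(‖z‖ ^ 2 + η ^ 2)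

theorem smoothNorm_pos {η : ℝ} (hη : 0 < η) (z : E d) : 0 < smoothNorm η z :=
  Real.sqrt_pos.2 (by positivity)

theorem norm_le_smoothNorm (η : ℝ) (z : E d) : ‖z‖ ≤ smoothNorm η z :=
  Real.le_sqrt_of_sq_le (by linarith [sq_nonneg η])

theorem smoothNorm_sub_comm (η : ℝ) (x y : E d) : smoothNorm η (x - y) = smoothNorm η (y - x) := by
  rw [smoothNorm, smoothNorm, norm_sub_rev]

theorem contDiff_smoothNorm {η : ℝ} (hη : 0 < η) {n : WithTop ℕ∞} :
    ContDiff ℝ n (smoothNorm η : E d → ℝ) :=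
  ((contDiff_norm_sq ℝ).add contDiff_const).sqrt fun z => by positivity

theorem continuous_smoothNorm (η : ℝ) : Continuous (smoothNorm η : E d → ℝ) := by
  unfold smoothNorm
  fun_prop

theorem gradient_smoothNorm {η : ℝ} (hη : 0 < η) (m k : ℝ) (c x : E d) :
    gradient (fun x => m * smoothNorm η (x - c) + k) x = (m / smoothNorm η (x - c)) • (x - c) := by
  have hp := smoothNorm_pos hη (x - c)
  refine HasGradientAt.gradient ?_
  rw [hasGradientAt_iff_hasFDerivAt]
  have h1 : HasFDerivAt (fun x : E d => ‖x - c‖ ^ 2 + η ^ 2) (2 • innerSL ℝ (x - c)) x := by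
    have := ((hasFDerivAt_id x).sub_const c).norm_sq
    simpa using this.add_const (η ^ 2)
  have h2 := ((h1.sqrt (by positivity)).const_mul m).add_const k
  refine h2.congr_fderiv ?_
  ext v
  change m * (1 / (2 * smoothNorm η (x - c)) * _) = _
  simp
  field_simp

/-- Serves both halves of the doubling: m = M in the variables (t,x), and the constant m = -M(t)
with -k in the variables (s,y). -/
theorem isTestFunction_smoothNorm {m : ℝ → ℝ} (hm : ContinuousOn m (Icc 0 T))
    (hm1 : ContDiffOn ℝ 1 m (Ioc 0 T)) (hmi : IntegrableOn (deriv m) (Ioo 0 T)) {η : ℝ}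
    (hη : 0 < η) (c : E d) (s k : ℝ) :
    IsTestFunction T fun t x => m t * smoothNorm η (x - c) + k * (t - s) ^ 2 := by
  refine ⟨?_, ?_, fun x => ?_⟩
  · have h1 : ContinuousOn (fun q : ℝ × E d => m q.1) (closedQ d T) :=
      hm.comp continuousOn_fst fun q hq => hq.1
    have h2 : Continuous fun q : ℝ × E d => smoothNorm η (q.2 - c) :=
      (continuous_smoothNorm η).comp (by fun_prop)
    exact (h1.mul h2.continuousOn).add (by fun_prop)
  · have h1 : ContDiffOn ℝ 1 (fun q : ℝ × E d => m q.1) (Ioc 0 T ×ˢ univ) :=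
      hm1.comp contDiffOn_fst fun q hq => hq.1
    have h2 : ContDiff ℝ 1 fun q : ℝ × E d => smoothNorm η (q.2 - c) :=
      (contDiff_smoothNorm hη).comp (contDiff_snd.sub contDiff_const)
    exact (h1.mul h2.contDiffOn).add (by fun_prop)
  · have hi : IntegrableOn (fun t => deriv m t * smoothNorm η (x - c) + k * (2 * (t - s)))
        (Ioo 0 T) := by
      refine Integrable.add (hmi.mul_const _) ?_
      have : Continuous fun t : ℝ => k * (2 * (t - s)) := by fun_prop
      exact (this.integrableOn_Icc (a := 0) (b := T)).mono_set Ioo_subset_Icc_self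
    refine hi.congr_fun (fun t ht => ?_) measurableSet_Ioo
    refine (HasDerivAt.deriv ?_).symm
    have hd : HasDerivAt m (deriv m t) t :=
      ((hm1.differentiableOn one_ne_zero).differentiableAt
        (mem_of_superset (Ioo_mem_nhds ht.1 ht.2) Ioo_subset_Ioc_self)).hasDerivAt
    have hq : HasDerivAt (fun t : ℝ => k * (t - s) ^ 2) (k * (2 * (t - s))) t := by
      have := (((hasDerivAt_id t).sub_const s).pow 2).const_mul k
      simpa using this
    exact (hd.mul_const _).add hq

/-! ### Doubling of variables -/

/-- The positive part is 1-Lipschitz, so moving both times back by the same τ cannot increase the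
penalty, even if only one of them reaches 0. -/
theorem sq_clip_sub_clip_le (t s τ : ℝ) :
    (max (t - τ) 0 - max (s - τ) 0) ^ 2 ≤ (t - s) ^ 2 := by
  refine sq_le_sq.2 ((abs_max_sub_max_le_abs _ _ _).trans (le_of_eq ?_))
  congr 1
  ring

theorem clip_mem {t τ : ℝ} (ht : t ∈ Icc 0 T) (hτ : 0 ≤ τ) : max (t - τ) 0 ∈ Icc 0 T :=
  ⟨le_max_right _ _, max_le (by linarith [ht.2]) (ht.1.trans ht.2)⟩

/-- At a maximum of the doubled functional, the Caputo derivative of the weight is controlled by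
the difference of the Hamiltonians. -/
theorem caputo_mul_smoothNorm_le (hα : α ∈ Ioo (0 : ℝ) 1)
    (hc : ContinuousOn (fun q : ℝ × E d => u q.1 q.2) (closedQ d T))
    (hsub : IsSubsolution α T H u) (hsuper : IsSupersolution α T H u)
    {M : ℝ → ℝ} (hM : ContinuousOn M (Icc 0 T)) (hM1 : ContDiffOn ℝ 1 M (Ioc 0 T))
    (hMi : IntegrableOn (deriv M) (Ioo 0 T)) {η k : ℝ} (hη : 0 < η) (hk : 0 ≤ k)
    {t s : ℝ} (ht : t ∈ Ioc 0 T) (hs : s ∈ Ioc 0 T)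
    (hMt : IntegrableOn (caputoIntegrand α M t) (Ioi 0)) {x y : E d}
    (hmax : ∀ t' ∈ Icc 0 T, ∀ s' ∈ Icc 0 T, ∀ x' y',
      u t' x' - u s' y' - M t' * smoothNorm η (x' - y') - k * (t' - s') ^ 2 ≤
        u t x - u s y - M t * smoothNorm η (x - y) - k * (t - s) ^ 2) :
    caputo α M t * smoothNorm η (x - y) ≤
      H s y (u s y) ((M t / smoothNorm η (x - y)) • (x - y)) -
        H t x (u t x) ((M t / smoothNorm η (x - y)) • (x - y)) := by
  have ht' : t ∈ Icc 0 T := ⟨ht.1.le, ht.2⟩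
  have hs' : s ∈ Icc 0 T := ⟨hs.1.le, hs.2⟩
  have h1 := hsub.caputo_le hα hc (isTestFunction_smoothNorm hM hM1 hMi hη y s k) ht (x := x)
    fun t' ht1 x' => by
      have := hmax t' ht1 s hs' x' y
      linarith
  have h2 := hsuper.le_caputo hα hc (isTestFunction_smoothNorm (m := fun _ => -M t)
    continuousOn_const contDiffOn_const (by simp) hη x t (-k)) hs (x := y)
    fun s' hs1 y' => by
      have := hmax t ht' s' hs1 x y'
      rw [smoothNorm_sub_comm η x y, smoothNorm_sub_comm η x y'] at this
      have e1 : (t - s') ^ 2 = (s' - t) ^ 2 := by ring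
      have e2 : (t - s) ^ 2 = (s - t) ^ 2 := by ring
      rw [e1, e2] at this
      linarith
  rw [gradient_smoothNorm hη] at h1 h2
  -- The sign of the weight and that of the displacement cancel: both inequalities carry the same
  -- momentum.
  have hp : (-M t / smoothNorm η (y - x)) • (y - x) =
      (M t / smoothNorm η (x - y)) • (x - y) := by
    rw [smoothNorm_sub_comm η y x, neg_div, neg_smul, ← smul_neg, neg_sub]
  rw [hp] at h2
  have hG := Real.Gamma_pos_of_pos (show 0 < 1 - α by linarith [hα.2])
  have h3 : caputo α M t * smoothNorm η (x - y) ≤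
      caputo α (fun s => u s x) t - caputo α (fun t => u t y) s := by
    rw [caputo, caputo, caputo, ← mul_sub, ← integral_sub h1.1 h2.1, mul_assoc,
      ← integral_mul_const]
    refine mul_le_mul_of_nonneg_left ?_ (div_pos hα.1 hG).le
    refine setIntegral_mono_on (hMt.mul_const _) (h1.1.sub h2.1) measurableSet_Ioi fun τ hτ => ?_
    have hτ0 : 0 < τ := hτ
    have hpow : 0 < τ ^ (α + 1) := Real.rpow_pos_of_pos hτ0 _
    -- The competitor keeps x and y and moves both times back by τ, which compares the integrands
    -- pointwise.
    have h := hmax _ (clip_mem ht' hτ0.le) _ (clip_mem hs' hτ0.le) x y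
    have hq := mul_le_mul_of_nonneg_left (sq_clip_sub_clip_le t s τ) hk
    simp only [caputoIntegrand]
    rw [← sub_div, div_mul_eq_mul_div]
    refine div_le_div_of_nonneg_right ?_ hpow.le
    linarith
  linarith [h1.2, h2.2]

/-! ### Existence and convergence of the maximizers -/

theorem exists_norm_add_le (x : E d) :
    ∃ z : Fin d → ℤ, ‖x + WithLp.toLp 2 (fun i => (z i : ℝ))‖ ≤ √d := by
  refine ⟨fun i => -⌊x i⌋, ?_⟩
  rw [EuclideanSpace.norm_eq]
  refine Real.sqrt_le_sqrt ?_
  calc _ ≤ ∑ _i : Fin d, (1 : ℝ) := Finset.sum_le_sum fun i _ => by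
        have e : (x + WithLp.toLp 2 (fun i => ((-⌊x i⌋ : ℤ) : ℝ))) i = Int.fract (x i) := by
          simp [Int.fract, sub_eq_add_neg]
        rw [e, Real.norm_of_nonneg (Int.fract_nonneg _)]
        exact pow_le_one₀ (Int.fract_nonneg _) (Int.fract_lt_one _).le
    _ = d := by simp

theorem exists_abs_le_of_periodic
    (hc : ContinuousOn (fun q : ℝ × E d => u q.1 q.2) (closedQ d T))
    (hper : ∀ t ∈ Icc 0 T, IsPeriodic (u t)) :
    ∃ C, ∀ t ∈ Icc 0 T, ∀ x, |u t x| ≤ C := by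
  have hK : IsCompact (Icc 0 T ×ˢ Metric.closedBall (0 : E d) √d) :=
    isCompact_Icc.prod (isCompact_closedBall _ _)
  obtain ⟨C, hC⟩ := hK.exists_bound_of_continuousOn
    (hc.mono (prod_mono_right (subset_univ _)))
  refine ⟨C, fun t ht x => ?_⟩
  obtain ⟨z, hz⟩ := exists_norm_add_le x
  rw [← hper t ht x z]
  exact hC (t, _) ⟨ht, mem_closedBall_zero_iff.2 hz⟩

/-- The functional with doubled variables `(t, s, x, y)`. -/
noncomputable def doubled (u : ℝ → E d → ℝ) (M : ℝ → ℝ) (η k : ℝ) (q : ℝ × ℝ × E d × E d) : ℝ :=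
  u q.1 q.2.2.1 - u q.2.1 q.2.2.2 - M q.1 * smoothNorm η (q.2.2.1 - q.2.2.2) -
    k * (q.1 - q.2.1) ^ 2

theorem continuousOn_doubled {M : ℝ → ℝ} {η k : ℝ}
    (hc : ContinuousOn (fun q : ℝ × E d => u q.1 q.2) (closedQ d T))
    (hM : ContinuousOn M (Icc 0 T)) :
    ContinuousOn (doubled u M η k) (Icc 0 T ×ˢ Icc 0 T ×ˢ univ) := by
  have h1 : ContinuousOn (fun q : ℝ × ℝ × E d × E d => u q.1 q.2.2.1)
      (Icc 0 T ×ˢ Icc 0 T ×ˢ univ) :=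
    hc.comp (f := fun q : ℝ × ℝ × E d × E d => (q.1, q.2.2.1)) (by fun_prop)
      fun q hq => ⟨hq.1, mem_univ _⟩
  have h2 : ContinuousOn (fun q : ℝ × ℝ × E d × E d => u q.2.1 q.2.2.2)
      (Icc 0 T ×ˢ Icc 0 T ×ˢ univ) :=
    hc.comp (f := fun q : ℝ × ℝ × E d × E d => (q.2.1, q.2.2.2)) (by fun_prop)
      fun q hq => ⟨hq.2.1, mem_univ _⟩
  have h3 : ContinuousOn (fun q : ℝ × ℝ × E d × E d => M q.1)
      (Icc 0 T ×ˢ Icc 0 T ×ˢ univ) := hM.comp continuousOn_fst fun q hq => hq.1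
  have h4 : Continuous fun q : ℝ × ℝ × E d × E d => smoothNorm η (q.2.2.1 - q.2.2.2) :=
    (continuous_smoothNorm η).comp (by fun_prop)
  exact ((h1.sub h2).sub (h3.mul h4.continuousOn)).sub (by fun_prop)

/-- Maximizers of the doubled functional exist in a compact set independent of the penalization
parameter. -/
theorem exists_doubled_max (hc : ContinuousOn (fun q : ℝ × E d => u q.1 q.2) (closedQ d T))
    (hper : ∀ t ∈ Icc 0 T, IsPeriodic (u t)) {M : ℝ → ℝ} (hM : ContinuousOn M (Icc 0 T))
    {m₀ η : ℝ} (hm₀ : 0 < m₀) (hMm : ∀ t ∈ Icc 0 T, m₀ ≤ M t)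
    {t₀ : ℝ} (ht₀ : t₀ ∈ Icc 0 T) {x₀ y₀ : E d}
    (hpos : 0 < u t₀ x₀ - u t₀ y₀ - M t₀ * smoothNorm η (x₀ - y₀)) :
    ∃ S : Set (ℝ × ℝ × E d × E d), IsCompact S ∧ S ⊆ Icc 0 T ×ˢ Icc 0 T ×ˢ univ ∧
      ∀ k : ℝ, 0 ≤ k → ∃ q ∈ S,
        u t₀ x₀ - u t₀ y₀ - M t₀ * smoothNorm η (x₀ - y₀) ≤ doubled u M η k q ∧
        ∀ t' ∈ Icc 0 T, ∀ s' ∈ Icc 0 T, ∀ x' y',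
          doubled u M η k (t', s', x', y') ≤ doubled u M η k q := by
  obtain ⟨C, hC⟩ := exists_abs_le_of_periodic hc hper
  have hC0 : 0 ≤ C := (abs_nonneg _).trans (hC t₀ ht₀ x₀)
  -- For |x-y| > ρ the weight exceeds 2C, a bound for differences of values of u, and the functional
  -- is negative.
  set ρ : ℝ := 2 * C / m₀ with hρ
  have hρ0 : 0 ≤ ρ := by positivity
  set S : Set (ℝ × ℝ × E d × E d) := Icc 0 T ×ˢ Icc 0 T ×ˢ Metric.closedBall 0 √d ×ˢ
    Metric.closedBall 0 (√d + ρ)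
  have hS : IsCompact S := isCompact_Icc.prod (isCompact_Icc.prod
    ((isCompact_closedBall _ _).prod (isCompact_closedBall _ _)))
  have hSsub : S ⊆ Icc 0 T ×ˢ Icc 0 T ×ˢ univ := prod_mono_right (prod_mono_right (subset_univ _))
  refine ⟨S, hS, hSsub, fun k hk => ?_⟩
  have hSne : S.Nonempty := ⟨(t₀, t₀, 0, 0), ht₀, ht₀,
    Metric.mem_closedBall_self (Real.sqrt_nonneg _), Metric.mem_closedBall_self (by positivity)⟩
  obtain ⟨q, hqS, hq⟩ := hS.exists_isMaxOn hSne ((continuousOn_doubled (k := k) (η := η)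
    hc hM).mono hSsub)
  -- Translating x and y by one lattice vector preserves the functional and brings x into the ball
  -- of radius √d.
  have near : ∀ t' ∈ Icc 0 T, ∀ s' ∈ Icc 0 T, ∀ x' y', ‖x' - y'‖ ≤ ρ →
      doubled u M η k (t', s', x', y') ≤ doubled u M η k q := by
    intro t' ht' s' hs' x' y' hxy
    obtain ⟨z, hz⟩ := exists_norm_add_le x'
    set v : E d := WithLp.toLp 2 (fun i => (z i : ℝ)) with hv
    have hy : ‖y' + v‖ ≤ √d + ρ := by
      have e : y' + v = (x' + v) - (x' - y') := by abel
      rw [e]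
      exact (norm_sub_le _ _).trans (add_le_add hz hxy)
    have h := hq (show (t', s', x' + v, y' + v) ∈ S from
      ⟨ht', hs', mem_closedBall_zero_iff.2 hz, mem_closedBall_zero_iff.2 hy⟩)
    have e : doubled u M η k (t', s', x' + v, y' + v) = doubled u M η k (t', s', x', y') := by
      simp only [doubled, add_sub_add_right_eq_sub]
      rw [hv, hper t' ht' x' z, hper s' hs' y' z]
    rw [← e]
    exact h
  have far : ∀ t' ∈ Icc 0 T, ∀ s' ∈ Icc 0 T, ∀ x' y', ρ < ‖x' - y'‖ →
      doubled u M η k (t', s', x', y') < 0 := by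
    intro t' ht' s' hs' x' y' hxy
    have h1 := (abs_le.1 (hC t' ht' x')).2
    have h2 := (abs_le.1 (hC s' hs' y')).1
    have h3 : 2 * C < M t' * smoothNorm η (x' - y') :=
      calc 2 * C = m₀ * ρ := by rw [hρ]; field_simp
        _ < m₀ * smoothNorm η (x' - y') :=
          mul_lt_mul_of_pos_left (hxy.trans_le (norm_le_smoothNorm _ _)) hm₀
        _ ≤ _ := mul_le_mul_of_nonneg_right (hMm t' ht') (Real.sqrt_nonneg _)
    have h4 : 0 ≤ k * (t' - s') ^ 2 := by positivity
    simp only [doubled]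
    linarith
  have e0 : doubled u M η k (t₀, t₀, x₀, y₀) =
      u t₀ x₀ - u t₀ y₀ - M t₀ * smoothNorm η (x₀ - y₀) := by
    simp [doubled]
  have hbase : u t₀ x₀ - u t₀ y₀ - M t₀ * smoothNorm η (x₀ - y₀) ≤ doubled u M η k q := by
    rw [← e0]
    refine near t₀ ht₀ t₀ ht₀ x₀ y₀ (le_of_not_gt fun h => ?_)
    have := far t₀ ht₀ t₀ ht₀ x₀ y₀ h
    linarith
  refine ⟨q, hqS, hbase, fun t' ht' s' hs' x' y' => ?_⟩
  rcases le_or_gt ‖x' - y'‖ ρ with h | h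
  · exact near t' ht' s' hs' x' y' h
  · exact ((far t' ht' s' hs' x' y' h).trans (hpos.trans_le hbase)).le

/-- Lets the term L₂|x-y||p| of the structure condition be absorbed by L₂Mψ. -/
theorem norm_div_smul_mul_le {η m : ℝ} (hη : 0 < η) (hm : 0 ≤ m) (z : E d) :
    ‖z‖ * ‖(m / smoothNorm η z) • z‖ ≤ m * smoothNorm η z := by
  have hp := smoothNorm_pos hη z
  have hz := norm_le_smoothNorm η z
  rw [norm_smul, Real.norm_of_nonneg (div_nonneg hm hp.le)]
  have h1 : m / smoothNorm η z * ‖z‖ ≤ m := by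
    rw [div_mul_eq_mul_div, div_le_iff₀ hp]
    exact mul_le_mul_of_nonneg_left hz hm
  calc _ ≤ ‖z‖ * m := mul_le_mul_of_nonneg_left h1 (norm_nonneg _)
    _ ≤ smoothNorm η z * m := mul_le_mul_of_nonneg_right hz hm
    _ = _ := mul_comm _ _

/-- Spatial modulus of continuity bounded by a strict supersolution `M` of the linear fractional
equation. -/
theorem sub_le_mul_smoothNorm (hα : α ∈ Ioo (0 : ℝ) 1)
    (hHcont : ContinuousOn (fun q : ℝ × E d × ℝ × E d => H q.1 q.2.1 q.2.2.1 q.2.2.2)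
      (Icc 0 T ×ˢ univ))
    (hHmono : ∀ t ∈ Icc 0 T, ∀ x p : E d, Monotone (fun r => H t x r p))
    {L₁ L₂ : ℝ} (hL₁ : 0 ≤ L₁) (hL₂ : 0 ≤ L₂)
    (hHlip : ∀ t ∈ Ioc 0 T, ∀ (x y : E d) (r : ℝ) (p : E d),
      |H t x r p - H t y r p| ≤ L₁ * ‖x - y‖ + L₂ * ‖x - y‖ * ‖p‖)
    (hc : ContinuousOn (fun q : ℝ × E d => u q.1 q.2) (closedQ d T))
    (hsub : IsSubsolution α T H u) (hsuper : IsSupersolution α T H u)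
    {M : ℝ → ℝ} (hM : ContinuousOn M (Icc 0 T)) (hM1 : ContDiffOn ℝ 1 M (Ioc 0 T))
    (hMi : IntegrableOn (deriv M) (Ioo 0 T)) {m₀ κ η : ℝ} (hm₀ : 0 < m₀) (hκ : 0 < κ)
    (hη : 0 < η) (hMm : ∀ t ∈ Icc 0 T, m₀ ≤ M t)
    (hMint : ∀ t ∈ Ioc 0 T, IntegrableOn (caputoIntegrand α M t) (Ioi 0))
    (hMcap : ∀ t ∈ Ioc 0 T, L₂ * M t + L₁ + κ ≤ caputo α M t)
    (h0 : ∀ x y, u 0 x - u 0 y ≤ M 0 * ‖x - y‖) {t : ℝ} (ht : t ∈ Icc 0 T) (x y : E d) :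
    u t x - u t y ≤ M t * smoothNorm η (x - y) := by
  by_contra! hcon
  have hθ := sub_pos.2 hcon
  set θ := u t x - u t y - M t * smoothNorm η (x - y)
  obtain ⟨S, hS, hSsub, hmax⟩ := exists_doubled_max hc hsub.periodic hM hm₀ hMm ht hθ
  obtain ⟨C, hC⟩ := exists_abs_le_of_periodic hc hsub.periodic
  choose q hqS hqθ hqmax using fun n : ℕ => hmax ((n : ℝ) + 1) (by positivity)
  obtain ⟨q', hq'S, φ, hφ, hlim⟩ := hS.tendsto_subseq hqS
  obtain ⟨a, b, X, Y⟩ := q'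
  have hmem : ∀ n, (q n).1 ∈ Icc 0 T ∧ (q n).2.1 ∈ Icc 0 T := fun n =>
    ⟨(hSsub (hqS n)).1, (hSsub (hqS n)).2.1⟩
  have ha : a ∈ Icc 0 T := (hSsub hq'S).1
  have hb : b ∈ Icc 0 T := (hSsub hq'S).2.1
  have l1 : Tendsto (fun n => (q (φ n)).1) atTop (𝓝 a) :=
    (continuous_fst.tendsto _).comp hlim
  have l2 : Tendsto (fun n => (q (φ n)).2.1) atTop (𝓝 b) :=
    ((continuous_fst.comp continuous_snd).tendsto _).comp hlim
  have l3 : Tendsto (fun n => (q (φ n)).2.2.1) atTop (𝓝 X) :=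
    ((continuous_fst.comp (continuous_snd.comp continuous_snd)).tendsto _).comp hlim
  have l4 : Tendsto (fun n => (q (φ n)).2.2.2) atTop (𝓝 Y) :=
    ((continuous_snd.comp (continuous_snd.comp continuous_snd)).tendsto _).comp hlim
  -- The maximum is positive and differences of u are at most 2C, so k(t-s)² ≤ 2C with k = φ n + 1.
  have hab : a = b := by
    have hle : ∀ n, ((q (φ n)).1 - (q (φ n)).2.1) ^ 2 ≤ 2 * C * (1 / ((φ n : ℝ) + 1)) := by
      intro n
      have h := hθ.trans_le (hqθ (φ n))
      simp only [doubled] at h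
      have h1 := (abs_le.1 (hC _ (hmem (φ n)).1 (q (φ n)).2.2.1)).2
      have h2 := (abs_le.1 (hC _ (hmem (φ n)).2 (q (φ n)).2.2.2)).1
      have h3 := mul_nonneg (hm₀.le.trans (hMm _ (hmem (φ n)).1))
        (smoothNorm_pos hη ((q (φ n)).2.2.1 - (q (φ n)).2.2.2)).le
      rw [mul_one_div, le_div_iff₀ (by positivity)]
      linarith
    have hz : Tendsto (fun n => 2 * C * (1 / ((φ n : ℝ) + 1))) atTop (𝓝 0) := by
      simpa using ((tendsto_one_div_add_atTop_nhds_zero_nat (𝕜 := ℝ)).comp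
        hφ.tendsto_atTop).const_mul (2 * C)
    have h := le_of_tendsto_of_tendsto' ((l1.sub l2).pow 2) hz hle
    exact sub_eq_zero.1 (pow_eq_zero_iff two_ne_zero |>.1 (le_antisymm h (sq_nonneg _)))
  subst hab
  have lu : ∀ {f : ℕ → ℝ} {g : ℕ → E d} {Z : E d}, (∀ n, f n ∈ Icc 0 T) →
      Tendsto f atTop (𝓝 a) → Tendsto g atTop (𝓝 Z) →
      Tendsto (fun n => u (f n) (g n)) atTop (𝓝 (u a Z)) := by
    intro f g Z hf h1 h2
    exact (hc (a, Z) ⟨ha, mem_univ _⟩).tendsto.comp (tendsto_nhdsWithin_iff.2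
      ⟨h1.prodMk_nhds h2, Eventually.of_forall fun n => ⟨hf n, mem_univ _⟩⟩)
  have lux := lu (fun n => (hmem (φ n)).1) l1 l3
  have luy := lu (fun n => (hmem (φ n)).2) l2 l4
  have lM : Tendsto (fun n => M (q (φ n)).1) atTop (𝓝 (M a)) :=
    (hM a ha).tendsto.comp (tendsto_nhdsWithin_iff.2
      ⟨l1, Eventually.of_forall fun n => (hmem (φ n)).1⟩)
  have lψ : Tendsto (fun n => smoothNorm η ((q (φ n)).2.2.1 - (q (φ n)).2.2.2)) atTop
      (𝓝 (smoothNorm η (X - Y))) :=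
    ((continuous_smoothNorm η).tendsto _).comp (l3.sub l4)
  have hψ := smoothNorm_pos hη (X - Y)
  have hMa := hm₀.trans_le (hMm a ha)
  -- The excess θ survives in the limit, since the discarded penalty is nonnegative.
  have hgap : θ ≤ u a X - u a Y - M a * smoothNorm η (X - Y) := by
    refine ge_of_tendsto' ((lux.sub luy).sub (lM.mul lψ)) fun n => (hqθ (φ n)).trans ?_
    simp only [doubled]
    have : 0 ≤ ((φ n : ℝ) + 1) * ((q (φ n)).1 - (q (φ n)).2.1) ^ 2 := by positivity
    linarith
  have ha0 : 0 < a := by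
    rcases ha.1.eq_or_lt with h | h
    · rw [← h] at hgap hMa
      have h1 := h0 X Y
      have h2 := mul_le_mul_of_nonneg_left (norm_le_smoothNorm η (X - Y)) hMa.le
      linarith
    · exact h
  set p : ℕ → E d := fun n => (M (q (φ n)).1 /
    smoothNorm η ((q (φ n)).2.2.1 - (q (φ n)).2.2.2)) • ((q (φ n)).2.2.1 - (q (φ n)).2.2.2)
  set P : E d := (M a / smoothNorm η (X - Y)) • (X - Y)
  have lp : Tendsto p atTop (𝓝 P) := (lM.div lψ hψ.ne').smul (l3.sub l4)
  have lH : ∀ {f : ℕ → ℝ} {g : ℕ → E d} {r : ℕ → ℝ} {Z : E d} {R : ℝ}, (∀ n, f n ∈ Icc 0 T) →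
      Tendsto f atTop (𝓝 a) → Tendsto g atTop (𝓝 Z) → Tendsto r atTop (𝓝 R) →
      Tendsto (fun n => H (f n) (g n) (r n) (p n)) atTop (𝓝 (H a Z R P)) := by
    intro f g r Z R hf h1 h2 h3
    exact (hHcont (a, Z, R, P) ⟨ha, mem_univ _⟩).tendsto.comp (tendsto_nhdsWithin_iff.2
      ⟨h1.prodMk_nhds (h2.prodMk_nhds (h3.prodMk_nhds lp)),
        Eventually.of_forall fun n => ⟨hf n, mem_univ _⟩⟩)
  have key : (L₂ * M a + L₁ + κ) * smoothNorm η (X - Y) ≤ H a Y (u a Y) P - H a X (u a X) P := by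
    refine le_of_tendsto_of_tendsto ((((lM.const_mul L₂).add_const L₁).add_const κ).mul lψ)
      ((lH (fun n => (hmem (φ n)).2) l2 l4 luy).sub (lH (fun n => (hmem (φ n)).1) l1 l3 lux)) ?_
    filter_upwards [l1.eventually_const_lt ha0, l2.eventually_const_lt ha0] with n hn1 hn2
    have ht1 : (q (φ n)).1 ∈ Ioc 0 T := ⟨hn1, (hmem (φ n)).1.2⟩
    have h := caputo_mul_smoothNorm_le hα hc hsub hsuper hM hM1 hMi hη (by positivity) ht1
      ⟨hn2, (hmem (φ n)).2.2⟩ (hMint _ ht1) (hqmax (φ n))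
    exact (mul_le_mul_of_nonneg_right (hMcap _ ht1) (smoothNorm_pos hη _).le).trans h
  -- Positivity of the gap orders the two values, so monotonicity of H replaces u(a,Y) by u(a,X) and
  -- the structure condition applies with equal r. The outcome κψ ≤ 0 is absurd, since ψ > 0 even
  -- when X = Y.
  have hu : u a Y ≤ u a X := by
    have := mul_pos hMa hψ
    linarith
  have hmono := hHmono a ha Y P hu
  simp only at hmono
  have hl := (le_abs_self _).trans (hHlip a ⟨ha0, ha.2⟩ Y X (u a X) P)
  rw [norm_sub_rev Y X, mul_assoc L₂] at hl
  have h1 := mul_le_mul_of_nonneg_left (norm_div_smul_mul_le hη hMa.le (X - Y)) hL₂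
  have h2 := mul_le_mul_of_nonneg_left (norm_le_smoothNorm η (X - Y)) hL₁
  have h3 := mul_pos hκ hψ
  linarith

/-! ### The Mittag-Leffler bound by removal of the perturbations -/

theorem sub_le_mittagLeffler_mul (hα : α ∈ Ioo (0 : ℝ) 1) (hT : 0 < T)
    (hHcont : ContinuousOn (fun q : ℝ × E d × ℝ × E d => H q.1 q.2.1 q.2.2.1 q.2.2.2)
      (Icc 0 T ×ˢ univ))
    (hHmono : ∀ t ∈ Icc 0 T, ∀ x p : E d, Monotone (fun r => H t x r p))
    {u₀ : E d → ℝ} (hu₀ : ∃ C : ℝ≥0, LipschitzWith C u₀)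
    {L₁ L₂ : ℝ} (hL₁ : 0 ≤ L₁) (hL₂ : 0 < L₂)
    (hHlip : ∀ t ∈ Ioc 0 T, ∀ (x y : E d) (r : ℝ) (p : E d),
      |H t x r p - H t y r p| ≤ L₁ * ‖x - y‖ + L₂ * ‖x - y‖ * ‖p‖)
    (hu : IsSolutionIVP α T H u₀ u) {t : ℝ} (ht : t ∈ Icc 0 T) (x y : E d) :
    u t x - u t y ≤
      (((lip u₀ : ℝ) + L₁ / L₂) * mittagLeffler α (L₂ * t ^ α) - L₁ / L₂) * ‖x - y‖ := by
  set B := L₁ / L₂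
  have hB : 0 ≤ B := div_nonneg hL₁ hL₂.le
  have approx : ∀ ε > 0, u t x - u t y ≤
      ((lip u₀ + ε + B) * mittagLeffler α ((L₂ + ε) * t ^ α) - B) * ‖x - y‖ := by
    intro ε hε
    -- As S ≥ 1, this gives M ≥ Lip[u₀] + ε, which dominates the initial slope and stays positive
    -- even for constant u₀. The other ε, in the rate L₂ + ε, provides strictness.
    set A : ℝ := lip u₀ + ε + B
    have hA : 0 < A := by positivity
    obtain ⟨N, κ, hκ, hcap⟩ := exists_lt_caputo_mlSum (L₁ := L₁) hα hT hL₂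
      (show L₂ < L₂ + ε by linarith) hA
    set M : ℝ → ℝ := fun s => A * mlSum α (L₂ + ε) (N + 1) s - B
    have hM : Continuous M := ((continuous_mlSum hα.1 _).const_mul A).sub continuous_const
    have hMlow : ∀ s ∈ Icc 0 T, lip u₀ + ε ≤ M s := by
      intro s hs
      have := mul_le_mul_of_nonneg_left
        (one_le_mlSum hα.1 (l := L₂ + ε) (by linarith) hs.1 N) hA.le
      simp only [M, A] at this ⊢
      linarith
    have hM1 : ContDiffOn ℝ 1 M (Ioc 0 T) :=
      ((contDiffOn_const.mul (contDiffOn_mlSum _ _ _)).sub contDiffOn_const).mono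
        Ioc_subset_Ioi_self
    have hMi : IntegrableOn (deriv M) (Ioo 0 T) := by
      have : deriv M = fun s => A * deriv (mlSum α (L₂ + ε) (N + 1)) s := by
        ext s
        simp only [M]
        rw [deriv_sub_const, deriv_const_mul_field]
      rw [this]
      exact (integrableOn_deriv_mlSum hα.1 _).const_mul A
    have h0 : ∀ x y, u 0 x - u 0 y ≤ M 0 * ‖x - y‖ := by
      intro x y
      rw [hu.initial, hu.initial, ← dist_eq_norm]
      refine (le_abs_self _).trans (((lipschitzWith_lip hu₀).dist_le_mul x y).trans ?_)
      exact mul_le_mul_of_nonneg_right (by linarith [hMlow 0 ⟨le_rfl, hT.le⟩]) dist_nonneg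
    have hη : ∀ η > 0, u t x - u t y ≤ M t * smoothNorm η (x - y) := fun η hη =>
      sub_le_mul_smoothNorm hα hHcont hHmono hL₁ hL₂.le hHlip hu.continuousOn hu.sub hu.super
        hM.continuousOn hM1 hMi (m₀ := lip u₀ + ε) (by positivity) hκ hη hMlow
        (fun s hs => integrableOn_caputoIntegrand_mlSum hα hs.1 _) hcap h0 ht x y
    have hlim : Tendsto (fun η => M t * smoothNorm η (x - y)) (𝓝[>] 0) (𝓝 (M t * ‖x - y‖)) := by
      have hc : Continuous fun η : ℝ => M t * smoothNorm η (x - y) := by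
        unfold smoothNorm
        fun_prop
      have := hc.tendsto 0
      simp only [smoothNorm, ne_eq, OfNat.ofNat_ne_zero, not_false_eq_true, zero_pow, add_zero,
        Real.sqrt_sq (norm_nonneg _)] at this
      exact this.mono_left nhdsWithin_le_nhds
    refine (ge_of_tendsto hlim (eventually_mem_nhdsWithin.mono hη)).trans ?_
    refine mul_le_mul_of_nonneg_right (sub_le_sub_right ?_ _) (norm_nonneg _)
    exact mul_le_mul_of_nonneg_left
      (mlSum_le_mittagLeffler hα.1 (by linarith) ht.1 _) hA.le
  have htα : 0 ≤ t ^ α := Real.rpow_nonneg ht.1 _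
  have hlim : Tendsto (fun ε => ((lip u₀ + ε + B) * mittagLeffler α ((L₂ + ε) * t ^ α) - B) *
      ‖x - y‖) (𝓝[>] 0) (𝓝 (((lip u₀ + B) * mittagLeffler α (L₂ * t ^ α) - B) * ‖x - y‖)) := by
    have hml := continuousOn_mittagLeffler hα.1 ((L₂ + 1) * t ^ α) (by positivity)
    have hz : Tendsto (fun ε : ℝ => (L₂ + ε) * t ^ α) (𝓝[>] 0)
        (𝓝[Icc 0 ((L₂ + 1) * t ^ α)] (L₂ * t ^ α)) := by
      refine tendsto_nhdsWithin_iff.2 ⟨?_, ?_⟩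
      · have hc : Continuous fun ε : ℝ => (L₂ + ε) * t ^ α := by fun_prop
        have := hc.tendsto 0
        rw [add_zero] at this
        exact this.mono_left nhdsWithin_le_nhds
      · filter_upwards [Ioo_mem_nhdsGT (zero_lt_one' ℝ)] with ε hε
        exact ⟨mul_nonneg (by linarith [hε.1]) htα,
          mul_le_mul_of_nonneg_right (by linarith [hε.2]) htα⟩
    have h1 := (hml (L₂ * t ^ α) ⟨by positivity,
      mul_le_mul_of_nonneg_right (by linarith) htα⟩).tendsto.comp hz
    have h2 : Tendsto (fun ε : ℝ => (lip u₀ : ℝ) + ε + B) (𝓝[>] 0) (𝓝 (lip u₀ + B)) := by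
      have hc : Continuous fun ε : ℝ => (lip u₀ : ℝ) + ε + B := by fun_prop
      have := hc.tendsto 0
      rw [add_zero] at this
      exact this.mono_left nhdsWithin_le_nhds
    exact ((h2.mul h1).sub_const B).mul_const _
  exact ge_of_tendsto hlim (eventually_mem_nhdsWithin.mono approx)

end FracHJ

theorem mainTheorem8 {d : ℕ} (α T : ℝ) (hα : α ∈ Ioo (0 : ℝ) 1) (hT : 0 < T)
    (H : ℝ → FracHJ.E d → ℝ → FracHJ.E d → ℝ)
    (hHper : ∀ t ∈ Icc 0 T, ∀ (r : ℝ) (p : FracHJ.E d), FracHJ.IsPeriodic (fun x => H t x r p))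
    (hHcont : ContinuousOn
      (fun q : ℝ × FracHJ.E d × ℝ × FracHJ.E d => H q.1 q.2.1 q.2.2.1 q.2.2.2)
      (Icc 0 T ×ˢ univ))
    (hHmono : ∀ t ∈ Icc 0 T, ∀ x p : FracHJ.E d, Monotone (fun r => H t x r p))
    (u₀ : FracHJ.E d → ℝ) (hu₀per : FracHJ.IsPeriodic u₀)
    (hu₀ : ∃ C : ℝ≥0, LipschitzWith C u₀)
    (L₁ L₂ : ℝ) (hL₁ : 0 ≤ L₁) (hL₂ : 0 < L₂)
    (hHlip : ∀ t ∈ Ioc 0 T, ∀ (x y : FracHJ.E d) (r : ℝ) (p : FracHJ.E d),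
      |H t x r p - H t y r p| ≤ L₁ * ‖x - y‖ + L₂ * ‖x - y‖ * ‖p‖)
    (u : ℝ → FracHJ.E d → ℝ) (hu : FracHJ.IsSolutionIVP α T H u₀ u) :
    ∀ t ∈ Icc 0 T, ∀ x y : FracHJ.E d,
      |u t x - u t y| ≤
        (((FracHJ.lip u₀ : ℝ) + L₁ / L₂) * FracHJ.mittagLeffler α (L₂ * t ^ α) - L₁ / L₂)
          * ‖x - y‖ := by
  intro t ht x y
  rw [abs_le']
  refine ⟨FracHJ.sub_le_mittagLeffler_mul hα hT hHcont hHmono hu₀ hL₁ hL₂ hHlip hu ht x y, ?_⟩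
  rw [neg_sub, norm_sub_rev]
  exact FracHJ.sub_le_mittagLeffler_mul hα hT hHcont hHmono hu₀ hL₁ hL₂ hHlip hu ht y x
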